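/- **Setting.** A signature $\sigma=(\mathrm{Dom},\mathrm{Ran})$ consists of a nonempty finite set $\mathrm{Dom}$ of variables and, for each $X\in\mathrm{Dom}$, a nonempty finite set $\mathrm{Ran}(X)$ of values. An equation $\mathbf X=\mathbf x$ is a finite conjunction $X_1=x_1\wedge\dots\wedge X_n=x_n$ with $X_i\in\mathrm{Dom}$, $x_i\in\mathrm{Ran}(X_i)$, where the order of the conjuncts is disregarded (repetitions are kept); it is inconsistent if it contains $X=x$ and $X=x'$ with $x\ne x'$, and consistent otherwise. The languages $\mathcal{CO}[\sigma]$ (formulas $\alpha$) and $\mathcal{CO}_{\vee\mkern-10mu\vee}[\sigma]$ (formulas $\varphi$) are $$\alpha::=X=x\mid\neg\alpha\mid\alpha\wedge\alpha\mid\alpha\vee\alpha\mid\mathbf X=\mathbf x\,\mathrel{\Box\!\!\to}\alpha,\qquad \varphi::=X=x\mid\neg\alpha\mid\varphi\wedge\varphi\mid\varphi\vee\varphi\mid\varphi\mathbin{\vee\mkern-10mu\vee}\varphi\mid\mathbf X=\mathbf x\,\mathrel{\Box\!\!\to}\varphi,$$ with nonempty equations $\mathbf X=\mathbf x$ as antecedents.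 If $\mathbf X=\mathbf x$ is the empty equation, $\mathbf X=\mathbf x\,\mathrel{\Box\!\!\to}\varphi$ stands for $\varphi$. $X\ne x$ abbreviates $\neg(X=x)$, and $\bot$ abbreviates $X=x\wedge X\neq x$ (for any $X$, $x$). An empty disjunction is $\bot$. **Semantics.** An assignment $s$ gives each $X\in\mathrm{Dom}$ a value $s(X)\in\mathrm{Ran}(X)$. A system of functions $\mathcal F$ gives each variable $V$ of a set $\mathrm{En}(\mathcal F)\subseteq\mathrm{Dom}$ a set of parents $PA_V\subseteq\mathrm{Dom}\setminus\{V\}$ and a function $\mathcal F_V:\mathrm{Ran}(PA_V)\to\mathrm{Ran}(V)$; it is recursive if the graph with edges $(X,V)$, $X\in PA_V$, is acyclic. $s$ is compatible with $\mathcal F$ if $s(V)=\mathcal F_V(s(PA_V))$ for all $V\in\mathrm{En}(\mathcal F)$. A generalized causal team is a set $T$ of pairs $(s,\mathcal F)$ with $\mathcal F$ recursive and $s$ compatible with $\mathcal F$. For a consistent $\mathbf X=\mathbf x$, $T_{\mathbf X=\mathbf x}=\{(s_{\mathbf X=\mathbf x},\mathcal F_{\mathbf X=\mathbf x})\mid(s,\mathcal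 F)\in T\}$, where $\mathcal F_{\mathbf X=\mathbf x}$ is the restriction of $\mathcal F$ to $\mathrm{En}(\mathcal F)\setminus\mathbf X$, and recursively $s_{\mathbf X=\mathbf x}(V)=x_i$ if $V=X_i$, $s_{\mathbf X=\mathbf x}(V)=s(V)$ if $V\notin\mathrm{En}(\mathcal F)\cup\mathbf X$, and $s_{\mathbf X=\mathbf x}(V)=\mathcal F_V(s_{\mathbf X=\mathbf x}(PA_V))$ if $V\in\mathrm{En}(\mathcal F)\setminus\mathbf X$. Satisfaction: * $T\models X=x$ iff $s(X)=x$ for all $(s,\mathcal F)\in T$; * $T\models\neg\alpha$ iff $\{(s,\mathcal F)\}\not\models\alpha$ for all $(s,\mathcal F)\in T$; * $T\models\varphi\wedge\psi$ iff $T\models\varphi$ and $T\models\psi$; * $T\models\varphi\vee\psi$ iff $T=T_1\cup T_2$ for some $T_1\models\varphi$ and $T_2\models\psi$; * $T\models\varphi\mathbin{\vee\mkern-10mu\vee}\psi$ iff $T\models\varphi$ or $T\models\psi$; * $T\models\mathbf X=\mathbf x\,\mathrel{\Box\!\!\to}\varphi$ iff $\mathbf X=\mathbf x$ is inconsistent or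 $T_{\mathbf X=\mathbf x}\models\varphi$. $\Gamma\models^g\psi$ means that every generalized causal team over $\sigma$ that satisfies all formulas of $\Gamma$ satisfies $\psi$. **Deduction.** $\Gamma\vdash\psi$ means that $\psi$ has a natural deduction, with undischarged assumptions in $\Gamma$, by the following rules (premises / conclusion; $[\varphi]$ marks a discharged assumption; $\alpha$ ranges over $\mathcal{CO}[\sigma]$-formulas, the other Greek letters over $\mathcal{CO}_{\vee\mkern-10mu\vee}[\sigma]$-formulas; equations may be empty). * ValDef: / $\bigvee_{x\in\mathrm{Ran}(X)}X=x$. ValUnq: $X=x$ / $X\ne x'$, for $x\neq x'$. * $\wedge$I: $\varphi,\psi$ / $\varphi\wedge\psi$. $\wedge$E: $\varphi\wedge\psi$ / $\varphi$, and $\varphi\wedge\psi$ / $\psi$. $\vee$I: $\varphi$ / $\varphi\vee\psi$, and $\varphi$ / $\psi\vee\varphi$. $\vee$E: $\varphi\vee\psi$, $[\varphi]\dots\alpha$, $[\psi]\dots\alpha$ / $\alpha$. $\neg$I: $[\alpha]\dots\bot$ / $\neg\alpha$. $\neg$E: $\alpha,\neg\alpha$ / $\varphi$. RAA: $[\neg\alpha]\dots\bot$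 / $\alpha$. * $\mathrel{\Box\!\!\to}$Eff: / $(\mathbf X=\mathbf x\wedge Y=y)\,\mathrel{\Box\!\!\to} Y=y$. $\mathrel{\Box\!\!\to}$Cmp: $\mathbf X=\mathbf x\,\mathrel{\Box\!\!\to} W=w$, $\mathbf X=\mathbf x\,\mathrel{\Box\!\!\to}\gamma$ / $(\mathbf X=\mathbf x\wedge W=w)\,\mathrel{\Box\!\!\to}\gamma$, for $\gamma$ without $\mathrel{\Box\!\!\to}$. $\mathrel{\Box\!\!\to}\bot$E: $\mathbf X=\mathbf x\,\mathrel{\Box\!\!\to}\bot$ / $\varphi$, for consistent $\mathbf X=\mathbf x$. $\bot\mathrel{\Box\!\!\to}$E: / $(\mathbf Y=\mathbf y\wedge X=x\wedge X=x')\,\mathrel{\Box\!\!\to}\varphi$, for $x\ne x'$. $\mathrel{\Box\!\!\to}$Ctr and $\mathrel{\Box\!\!\to}$Wk: $(X=x\wedge X=x\wedge\mathbf Y=\mathbf y)\,\mathrel{\Box\!\!\to}\varphi$ / $(X=x\wedge\mathbf Y=\mathbf y)\,\mathrel{\Box\!\!\to}\varphi$, and conversely. $\mathrel{\Box\!\!\to}$Sub: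 $\mathbf X=\mathbf x\,\mathrel{\Box\!\!\to}\varphi$ and a derivation of $\psi$ from $[\varphi]$ alone / $\mathbf X=\mathbf x\,\mathrel{\Box\!\!\to}\psi$. $\mathrel{\Box\!\!\to}\wedge$I: $\mathbf X=\mathbf x\,\mathrel{\Box\!\!\to}\varphi$, $\mathbf X=\mathbf x\,\mathrel{\Box\!\!\to}\psi$ / $\mathbf X=\mathbf x\,\mathrel{\Box\!\!\to}\varphi\wedge\psi$. $\mathrel{\Box\!\!\to}\vee$Dst: $\mathbf X=\mathbf x\,\mathrel{\Box\!\!\to}\varphi\vee\psi$ / $(\mathbf X=\mathbf x\,\mathrel{\Box\!\!\to}\varphi)\vee(\mathbf X=\mathbf x\,\mathrel{\Box\!\!\to}\psi)$, and conversely. $\mathrel{\Box\!\!\to}$Extr: $\mathbf X=\mathbf x\,\mathrel{\Box\!\!\to}(\mathbf Y=\mathbf y\,\mathrel{\Box\!\!\to}\varphi)$ / $(\mathbf X'=\mathbf x'\wedge\mathbf Y=\mathbf y)\,\mathrel{\Box\!\!\to}\varphi$, for consistent $\mathbf X=\mathbf x$, where $\mathbf X'=\mathbf x'$ is the part of $\mathbf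 X=\mathbf x$ on the variables not in $\mathbf Y$. $\mathrel{\Box\!\!\to}$Exp: $(\mathbf X=\mathbf x\wedge\mathbf Y=\mathbf y)\,\mathrel{\Box\!\!\to}\varphi$ / $\mathbf X=\mathbf x\,\mathrel{\Box\!\!\to}(\mathbf Y=\mathbf y\,\mathrel{\Box\!\!\to}\varphi)$, for $\mathbf X\cap\mathbf Y=\emptyset$. $\neg\mathrel{\Box\!\!\to}$E: $\neg(\mathbf X=\mathbf x\,\mathrel{\Box\!\!\to}\alpha)$ / $\mathbf X=\mathbf x\,\mathrel{\Box\!\!\to}\neg\alpha$. * Recur: $X_1\leadsto X_2,\dots,X_{k-1}\leadsto X_k$ / $\neg(X_k\leadsto X_1)$, for distinct $X_1,\dots,X_k$, $k\ge2$, where $X\leadsto Y$ is the disjunction ($\vee$) of all formulas $\mathbf Z=\mathbf z\,\mathrel{\Box\!\!\to}\big((X=x\,\mathrel{\Box\!\!\to} Y=y)\wedge(X=x'\,\mathrel{\Box\!\!\to} Y=y')\big)$ with $\mathbf Z\subseteq\mathrm{Dom}\setminus\{X,Y\}$, $\mathbf z\in\mathrm{Ran}(\mathbf Z)$, $x\neq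 x'$ in $\mathrm{Ran}(X)$, $y\ne y'$ in $\mathrm{Ran}(Y)$. * $\vee$Com: $\varphi\vee\psi$ / $\psi\vee\varphi$. $\vee$Ass: $(\varphi\vee\psi)\vee\chi$ / $\varphi\vee(\psi\vee\chi)$. $\vee$Sub: $\varphi\vee\psi$, $[\varphi]\dots\chi$ / $\chi\vee\psi$. * $\mathbin{\vee\mkern-10mu\vee}$I: $\varphi$ / $\varphi\mathbin{\vee\mkern-10mu\vee}\psi$, and $\varphi$ / $\psi\mathbin{\vee\mkern-10mu\vee}\varphi$. $\mathbin{\vee\mkern-10mu\vee}$E: $\varphi\mathbin{\vee\mkern-10mu\vee}\psi$, $[\varphi]\dots\chi$, $[\psi]\dots\chi$ / $\chi$. $\vee\mathbin{\vee\mkern-10mu\vee}$Dst: $\varphi\vee(\psi\mathbin{\vee\mkern-10mu\vee}\chi)$ / $(\varphi\vee\psi)\mathbin{\vee\mkern-10mu\vee}(\varphi\vee\chi)$. $\mathrel{\Box\!\!\to}\mathbin{\vee\mkern-10mu\vee}$Dst: $\mathbf X=\mathbf x\,\mathrel{\Box\!\!\to}\psi\mathbin{\vee\mkern-10mu\vee}\chi$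 / $(\mathbf X=\mathbf x\,\mathrel{\Box\!\!\to}\psi)\mathbin{\vee\mkern-10mu\vee}(\mathbf X=\mathbf x\,\mathrel{\Box\!\!\to}\chi)$. **Theorem (Completeness).** For every signature $\sigma$ and every set $\Gamma\cup\{\psi\}$ of $\mathcal{CO}_{\vee\mkern-10mu\vee}[\sigma]$-formulas, $$\Gamma\vdash\psi\iff\Gamma\models^g\psi.$$ -/

import Mathlib

namespace CausalTeam

universe u v

/-! ### Signatures, equations, formulas -/

/-- A signature: a nonempty finite set of variables, each with a nonempty finite range. -/
structure Signature where
  Dom : Type u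
  Ran : Dom → Type v
  [domFintype : Fintype Dom]
  [domNonempty : Nonempty Dom]
  [ranFintype : ∀ X, Fintype (Ran X)]
  [ranNonempty : ∀ X, Nonempty (Ran X)]

attribute [instance] Signature.domFintype Signature.domNonempty
  Signature.ranFintype Signature.ranNonempty

/-- An equation `X₁ = x₁ ∧ … ∧ Xₙ = xₙ`, up to the order of its conjuncts
(repetitions are kept). -/
abbrev Equation (σ : Signature.{u, v}) := Multiset (Σ X : σ.Dom, σ.Ran X)

namespace Equation

variable {σ : Signature.{u, v}}

/-- No variable is equated with two distinct values. -/
def Consistent (e : Equation σ) : Prop :=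
  ∀ (X : σ.Dom) (x x' : σ.Ran X),
    (⟨X, x⟩ : Σ X : σ.Dom, σ.Ran X) ∈ e → (⟨X, x'⟩ : Σ X : σ.Dom, σ.Ran X) ∈ e → x = x'

open Classical in
/-- The value that a (consistent) equation gives to `V`, if `V` occurs in it. -/
noncomputable def value (e : Equation σ) (V : σ.Dom) : Option (σ.Ran V) :=
  if h : ∃ x : σ.Ran V, (⟨V, x⟩ : Σ X : σ.Dom, σ.Ran X) ∈ e then some h.choose else none

open Classical in
/-- The subequation of `e` on the variables that do not occur in `e'`. -/
noncomputable def sdiff (e e' : Equation σ) : Equation σ :=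
  e.filter fun p => ∀ q ∈ e', q.1 ≠ p.1

/-- The two equations have no variable in common. -/
def VarDisjoint (e e' : Equation σ) : Prop :=
  ∀ p ∈ e, ∀ q ∈ e', p.1 ≠ q.1

/-- The equation `Z = z` given by a partial assignment, whose domain is `Z`. -/
def ofPartial (z : ∀ V : σ.Dom, Option (σ.Ran V)) : Equation σ :=
  (Finset.univ : Finset σ.Dom).val.filterMap fun V => (z V).map (Sigma.mk V)

end Equation

/-- The language `CO[σ]`. The antecedent of a counterfactual is a conjunction of one or
more equations. -/
inductive CO (σ : Signature.{u, v}) : Type (max u v)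
  | atom (X : σ.Dom) (x : σ.Ran X) : CO σ
  | neg (α : CO σ) : CO σ
  | and (α β : CO σ) : CO σ
  | or (α β : CO σ) : CO σ
  | cf (e : {e : Equation σ // e ≠ 0}) (α : CO σ) : CO σ

/-- The language `CO[σ]` extended by the intuitionistic disjunction `ior`;
negation applies to `CO[σ]`-formulas only. -/
inductive COV (σ : Signature.{u, v}) : Type (max u v)
  | atom (X : σ.Dom) (x : σ.Ran X) : COV σ
  | neg (α : CO σ) : COV σ
  | and (φ ψ : COV σ) : COV σ
  | or (φ ψ : COV σ) : COV σ
  | ior (φ ψ : COV σ) : COV σ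
  | cf (e : {e : Equation σ // e ≠ 0}) (φ : COV σ) : COV σ

variable {σ : Signature.{u, v}}

/-- Every `CO[σ]`-formula is a formula of the extended language. -/
def CO.toCOV : CO σ → COV σ
  | .atom X x => .atom X x
  | .neg α => .neg α
  | .and α β => .and α.toCOV β.toCOV
  | .or α β => .or α.toCOV β.toCOV
  | .cf e α => .cf e α.toCOV

open Classical in
/-- `e □→ α`, where `e □→ α` is `α` if `e` is the empty equation. -/
noncomputable def CO.would (e : Equation σ) (α : CO σ) : CO σ :=
  if h : e = 0 then α else .cf ⟨e, h⟩ α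

open Classical in
/-- `e □→ φ`, where `e □→ φ` is `φ` if `e` is the empty equation. -/
noncomputable def COV.would (e : Equation σ) (φ : COV σ) : COV σ :=
  if h : e = 0 then φ else .cf ⟨e, h⟩ φ

theorem CO.toCOV_would (e : Equation σ) (α : CO σ) :
    (CO.would e α).toCOV = COV.would e α.toCOV := by
  unfold CO.would COV.would
  split <;> rfl

/-- The contradiction `X = x ∧ X ≠ x`; any choice of `X` and `x` may be written `⊥`. -/
def CO.bot (X : σ.Dom) (x : σ.Ran X) : CO σ := .and (.atom X x) (.neg (.atom X x))

/-- The contradiction `X = x ∧ X ≠ x` in the extended language. -/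
def COV.bot (X : σ.Dom) (x : σ.Ran X) : COV σ := .and (.atom X x) (.neg (.atom X x))

theorem CO.toCOV_bot (X : σ.Dom) (x : σ.Ran X) : (CO.bot X x).toCOV = COV.bot X x := rfl

/-- The disjunction of a list of formulas; it is `⊥` for the empty list. -/
noncomputable def CO.bigOr : List (CO σ) → CO σ
  | [] => CO.bot (Classical.arbitrary σ.Dom) (Classical.arbitrary _)
  | [α] => α
  | α :: β :: l => .or α (CO.bigOr (β :: l))

/-- No counterfactual occurs in the formula. -/
def CO.CfFree : CO σ → Prop
  | .atom _ _ => True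
  | .neg α => α.CfFree
  | .and α β => α.CfFree ∧ β.CfFree
  | .or α β => α.CfFree ∧ β.CfFree
  | .cf _ _ => False

/-- No counterfactual occurs in the formula. -/
def COV.CfFree : COV σ → Prop
  | .atom _ _ => True
  | .neg α => α.CfFree
  | .and φ ψ => φ.CfFree ∧ ψ.CfFree
  | .or φ ψ => φ.CfFree ∧ ψ.CfFree
  | .ior φ ψ => φ.CfFree ∧ ψ.CfFree
  | .cf _ _ => False

/-- The formula `⋁ {X = x ∣ x ∈ Ran X}`. -/
noncomputable def CO.valDef (X : σ.Dom) : CO σ :=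
  CO.bigOr ((Finset.univ : Finset (σ.Ran X)).toList.map fun x => .atom X x)

/-- The data of a disjunct of `X ⇝ Y`: a partial assignment `z` with domain `Z` and values
`(x, x')` of `X` and `(y, y')` of `Y`. -/
abbrev LeadsToIndex (X Y : σ.Dom) :=
  (∀ V : σ.Dom, Option (σ.Ran V)) × (σ.Ran X × σ.Ran X) × (σ.Ran Y × σ.Ran Y)

open Classical in
/-- The formula `X ⇝ Y` ("`X` causally affects `Y`"): the disjunction of all
`Z = z □→ ((X = x □→ Y = y) ∧ (X = x' □→ Y = y'))`
with `Z ⊆ Dom \ {X, Y}`, `z ∈ Ran Z`, `x ≠ x'` and `y ≠ y'`. -/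
noncomputable def CO.leadsTo (X Y : σ.Dom) : CO σ :=
  CO.bigOr <|
    ((Finset.univ : Finset (LeadsToIndex X Y)).filter fun i =>
        i.1 X = none ∧ i.1 Y = none ∧ i.2.1.1 ≠ i.2.1.2 ∧ i.2.2.1 ≠ i.2.2.2).toList.map
      fun i => CO.would (Equation.ofPartial i.1)
        (.and (CO.would {⟨X, i.2.1.1⟩} (.atom Y i.2.2.1))
          (CO.would {⟨X, i.2.1.2⟩} (.atom Y i.2.2.2)))

/-! ### Generalized causal teams -/

variable (σ) in
/-- Assignments over the signature. -/
abbrev Assignment := ∀ X : σ.Dom, σ.Ran X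

/-- The law of an endogenous variable `V`: its set of parents, which does not contain `V`,
and a function from the values of the parents to the values of `V`. -/
structure Law (V : σ.Dom) where
  parents : Set σ.Dom
  not_mem : V ∉ parents
  fn : (∀ P : parents, σ.Ran P) → σ.Ran V

variable (σ) in
/-- A system of functions: a partial map that gives a law to each endogenous variable;
`V` is exogenous if `law V = none`. -/
structure FunSystem where
  law : ∀ V : σ.Dom, Option (Law V)

namespace FunSystem

/-- The edges of the graph of the system: `X` is a parent of `Y`. -/
def Edge (F : FunSystem σ) (X Y : σ.Dom) : Prop := ∃ l, F.law Y = some l ∧ X ∈ l.parents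

/-- The graph of the system has no directed cycle. -/
def Recursive (F : FunSystem σ) : Prop := ∀ X, ¬ Relation.TransGen F.Edge X X

/-- `s V = F_V (s (PA_V))` for all endogenous `V`. -/
def Compatible (F : FunSystem σ) (s : Assignment σ) : Prop :=
  ∀ V l, F.law V = some l → s V = l.fn fun P => s P

/-- The restriction of the system to the endogenous variables that do not occur in `e`. -/
noncomputable def restrict (F : FunSystem σ) (e : Equation σ) : FunSystem σ where
  law V := match e.value V with
    | some _ => none
    | none => F.law V

theorem Recursive.wf {F : FunSystem σ} (hF : F.Recursive) : WellFounded F.Edge := by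
  have : IsTrans σ.Dom (Relation.TransGen F.Edge) := ⟨fun _ _ _ => Relation.TransGen.trans⟩
  have : Std.Irrefl (Relation.TransGen F.Edge) := ⟨hF⟩
  exact Subrelation.wf (fun h => Relation.TransGen.single h)
    (Finite.wellFounded_of_trans_of_irrefl (Relation.TransGen F.Edge))

theorem law_of_restrict {F : FunSystem σ} {e : Equation σ} {V : σ.Dom} {l : Law V}
    (h : (F.restrict e).law V = some l) : e.value V = none ∧ F.law V = some l := by
  unfold restrict at h
  cases hv : e.value V with
  | some x => simp [hv] at h
  | none => simpa [hv] using h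

theorem Recursive.restrict {F : FunSystem σ} (hF : F.Recursive) (e : Equation σ) :
    (F.restrict e).Recursive := fun X h =>
  hF X (Relation.TransGen.mono (fun _ _ ⟨l, hl, hm⟩ => ⟨l, (law_of_restrict hl).2, hm⟩) _ _ h)

/-- The assignment that results from `s` by the intervention `do(e)`, by recursion along
the graph of the system. -/
noncomputable def doAssign (F : FunSystem σ) (hF : F.Recursive) (e : Equation σ)
    (s : Assignment σ) : Assignment σ :=
  hF.wf.fix fun V ih =>
    match e.value V with
    | some x => x
    | none =>
      match hl : F.law V with
      | none => s V
      | some l => l.fn fun P => ih P ⟨l, hl, P.2⟩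

theorem doAssign_of_value {F : FunSystem σ} (hF : F.Recursive) {e : Equation σ}
    (s : Assignment σ) {V : σ.Dom} {x : σ.Ran V} (h : e.value V = some x) :
    F.doAssign hF e s V = x := by
  unfold doAssign
  rw [WellFounded.fix_eq]
  simp [h]

theorem doAssign_of_exogenous {F : FunSystem σ} (hF : F.Recursive) {e : Equation σ}
    (s : Assignment σ) {V : σ.Dom} (h : e.value V = none) (hl : F.law V = none) :
    F.doAssign hF e s V = s V := by
  unfold doAssign
  rw [WellFounded.fix_eq]
  simp only [h]
  split
  · rfl
  · simp_all

theorem doAssign_of_law {F : FunSystem σ} (hF : F.Recursive) {e : Equation σ}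
    (s : Assignment σ) {V : σ.Dom} {l : Law V} (h : e.value V = none)
    (hl : F.law V = some l) :
    F.doAssign hF e s V = l.fn fun P => F.doAssign hF e s P := by
  conv_lhs => unfold doAssign
  rw [WellFounded.fix_eq]
  simp only [h]
  split
  · simp_all
  · rename_i l' hl'
    obtain rfl : l' = l := by simpa [hl'] using hl
    rfl

theorem compatible_doAssign {F : FunSystem σ} (hF : F.Recursive) (e : Equation σ)
    (s : Assignment σ) : (F.restrict e).Compatible (F.doAssign hF e s) := fun _ _ h =>
  doAssign_of_law hF s (law_of_restrict h).1 (law_of_restrict h).2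

end FunSystem

variable (σ) in
/-- A pair of an assignment and a recursive system of functions that are compatible. -/
@[ext]
structure Model where
  s : Assignment σ
  F : FunSystem σ
  recursive : F.Recursive
  compatible : F.Compatible s

/-- The intervention `do(e)` on a model. It is used only for consistent `e`. -/
noncomputable def Model.intervene (m : Model σ) (e : Equation σ) : Model σ where
  s := m.F.doAssign m.recursive e m.s
  F := m.F.restrict e
  recursive := m.recursive.restrict e
  compatible := FunSystem.compatible_doAssign m.recursive e m.s

variable (σ) in
/-- (Recursive) generalized causal teams. -/
abbrev GTeam := Set (Model σ)

/-- Satisfaction of a `CO[σ]`-formula in a generalized causal team. -/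
def CO.Sat : CO σ → GTeam σ → Prop
  | .atom X x, T => ∀ m ∈ T, m.s X = x
  | .neg α, T => ∀ m ∈ T, ¬ α.Sat {m}
  | .and α β, T => α.Sat T ∧ β.Sat T
  | .or α β, T => ∃ T₁ T₂ : GTeam σ, T₁ ∪ T₂ = T ∧ α.Sat T₁ ∧ β.Sat T₂
  | .cf e α, T => ¬ e.1.Consistent ∨ α.Sat ((fun m => m.intervene e.1) '' T)

/-- Satisfaction of a formula of the extended language in a generalized causal team. -/
def COV.Sat : COV σ → GTeam σ → Prop
  | .atom X x, T => ∀ m ∈ T, m.s X = x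
  | .neg α, T => ∀ m ∈ T, ¬ α.Sat {m}
  | .and φ ψ, T => φ.Sat T ∧ ψ.Sat T
  | .or φ ψ, T => ∃ T₁ T₂ : GTeam σ, T₁ ∪ T₂ = T ∧ φ.Sat T₁ ∧ ψ.Sat T₂
  | .ior φ ψ, T => φ.Sat T ∨ ψ.Sat T
  | .cf e φ, T => ¬ e.1.Consistent ∨ φ.Sat ((fun m => m.intervene e.1) '' T)

theorem CO.sat_toCOV (α : CO σ) (T : GTeam σ) : α.toCOV.Sat T ↔ α.Sat T := by
  induction α generalizing T <;> simp_all [CO.toCOV, CO.Sat, COV.Sat]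

/-- `Γ ⊨ᵍ ψ`: every (recursive) generalized causal team that satisfies `Γ` satisfies `ψ`. -/
def Entails (Γ : Set (COV σ)) (ψ : COV σ) : Prop :=
  ∀ T : GTeam σ, (∀ φ ∈ Γ, φ.Sat T) → ψ.Sat T

/-! ### The system of natural deduction -/

/-- `Deriv Γ φ`: there is a natural deduction of `φ` whose undischarged assumptions are
in `Γ`. An assumption that a rule discharges is added to the set of assumptions of the
premise in question. Schematic letters `α` stand for `CO[σ]`-formulas. -/
inductive Deriv : Set (COV σ) → COV σ → Prop
  | assumption {Γ φ} : φ ∈ Γ → Deriv Γ φ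
  -- value ranges
  | valDef {Γ} (X : σ.Dom) : Deriv Γ (CO.valDef X).toCOV
  | valUnq {Γ} {X : σ.Dom} {x x' : σ.Ran X} : x ≠ x' →
      Deriv Γ (.atom X x) → Deriv Γ (.neg (.atom X x'))
  -- conjunction, disjunction, negation
  | andI {Γ φ ψ} : Deriv Γ φ → Deriv Γ ψ → Deriv Γ (.and φ ψ)
  | andE₁ {Γ φ ψ} : Deriv Γ (.and φ ψ) → Deriv Γ φ
  | andE₂ {Γ φ ψ} : Deriv Γ (.and φ ψ) → Deriv Γ ψ
  | orI₁ {Γ φ ψ} : Deriv Γ φ → Deriv Γ (.or φ ψ)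
  | orI₂ {Γ φ ψ} : Deriv Γ φ → Deriv Γ (.or ψ φ)
  | orE {Γ φ ψ} {α : CO σ} : Deriv Γ (.or φ ψ) → Deriv (insert φ Γ) α.toCOV →
      Deriv (insert ψ Γ) α.toCOV → Deriv Γ α.toCOV
  | negI {Γ} {α : CO σ} {X : σ.Dom} {x : σ.Ran X} :
      Deriv (insert α.toCOV Γ) (COV.bot X x) → Deriv Γ (.neg α)
  | negE {Γ φ} {α : CO σ} : Deriv Γ α.toCOV → Deriv Γ (.neg α) → Deriv Γ φ
  | raa {Γ} {α : CO σ} {X : σ.Dom} {x : σ.Ran X} :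
      Deriv (insert (.neg α) Γ) (COV.bot X x) → Deriv Γ α.toCOV
  -- counterfactuals
  | cfEff {Γ} (e : Equation σ) (Y : σ.Dom) (y : σ.Ran Y) :
      Deriv Γ (COV.would (⟨Y, y⟩ ::ₘ e) (.atom Y y))
  | cfCmp {Γ γ} {e : Equation σ} {W : σ.Dom} {w : σ.Ran W} : γ.CfFree →
      Deriv Γ (COV.would e (.atom W w)) → Deriv Γ (COV.would e γ) →
      Deriv Γ (COV.would (⟨W, w⟩ ::ₘ e) γ)
  | cfBotE {Γ φ} {e : Equation σ} {X : σ.Dom} {x : σ.Ran X} : e.Consistent →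
      Deriv Γ (COV.would e (COV.bot X x)) → Deriv Γ φ
  | botCfE {Γ} (φ) (e : Equation σ) {X : σ.Dom} {x x' : σ.Ran X} : x ≠ x' →
      Deriv Γ (COV.would (⟨X, x⟩ ::ₘ ⟨X, x'⟩ ::ₘ e) φ)
  | cfCtr {Γ φ} {e : Equation σ} {X : σ.Dom} {x : σ.Ran X} :
      Deriv Γ (COV.would (⟨X, x⟩ ::ₘ ⟨X, x⟩ ::ₘ e) φ) → Deriv Γ (COV.would (⟨X, x⟩ ::ₘ e) φ)
  | cfWk {Γ φ} {e : Equation σ} {X : σ.Dom} {x : σ.Ran X} :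
      Deriv Γ (COV.would (⟨X, x⟩ ::ₘ e) φ) → Deriv Γ (COV.would (⟨X, x⟩ ::ₘ ⟨X, x⟩ ::ₘ e) φ)
  | cfSub {Γ φ ψ} {e : Equation σ} :
      Deriv Γ (COV.would e φ) → Deriv {φ} ψ → Deriv Γ (COV.would e ψ)
  | cfAndI {Γ φ ψ} {e : Equation σ} :
      Deriv Γ (COV.would e φ) → Deriv Γ (COV.would e ψ) → Deriv Γ (COV.would e (.and φ ψ))
  | cfOrDst {Γ φ ψ} {e : Equation σ} : Deriv Γ (COV.would e (.or φ ψ)) →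
      Deriv Γ (.or (COV.would e φ) (COV.would e ψ))
  | cfOrDstInv {Γ φ ψ} {e : Equation σ} : Deriv Γ (.or (COV.would e φ) (COV.would e ψ)) →
      Deriv Γ (COV.would e (.or φ ψ))
  | cfExtr {Γ φ} {e e' : Equation σ} : e.Consistent →
      Deriv Γ (COV.would e (COV.would e' φ)) → Deriv Γ (COV.would (e.sdiff e' + e') φ)
  | cfExp {Γ φ} {e e' : Equation σ} : e.VarDisjoint e' →
      Deriv Γ (COV.would (e + e') φ) → Deriv Γ (COV.would e (COV.would e' φ))
  | negCfE {Γ} {α : CO σ} {e : Equation σ} :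
      Deriv Γ (.neg (CO.would e α)) → Deriv Γ (COV.would e (.neg α))
  | recur {Γ} {k : ℕ} (X : Fin (k + 2) → σ.Dom) : Function.Injective X →
      (∀ i : Fin (k + 1), Deriv Γ (CO.leadsTo (X i.castSucc) (X i.succ)).toCOV) →
      Deriv Γ (.neg (CO.leadsTo (X (Fin.last (k + 1))) (X 0)))
  -- additional rules for disjunction
  | orCom {Γ φ ψ} : Deriv Γ (.or φ ψ) → Deriv Γ (.or ψ φ)
  | orAss {Γ φ ψ χ} : Deriv Γ (.or (.or φ ψ) χ) → Deriv Γ (.or φ (.or ψ χ))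
  | orSub {Γ φ ψ χ} : Deriv Γ (.or φ ψ) → Deriv (insert φ Γ) χ → Deriv Γ (.or χ ψ)
  -- intuitionistic disjunction
  | iorI₁ {Γ φ ψ} : Deriv Γ φ → Deriv Γ (.ior φ ψ)
  | iorI₂ {Γ φ ψ} : Deriv Γ φ → Deriv Γ (.ior ψ φ)
  | iorE {Γ φ ψ χ} : Deriv Γ (.ior φ ψ) → Deriv (insert φ Γ) χ →
      Deriv (insert ψ Γ) χ → Deriv Γ χ
  | orIorDst {Γ φ ψ χ} : Deriv Γ (.or φ (.ior ψ χ)) →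
      Deriv Γ (.ior (.or φ ψ) (.or φ χ))
  | cfIorDst {Γ φ ψ} {e : Equation σ} : Deriv Γ (COV.would e (.ior φ ψ)) →
      Deriv Γ (.ior (COV.would e φ) (COV.would e ψ))

end CausalTeam

/-!
Soundness of `Deriv` is an induction on derivations. It rests on three properties of
satisfaction: all formulas are preserved under subteams (`COV.Sat.mono`), the empty team
satisfies all formulas (`COV.sat_empty`), and `CO`-formulas are flat (`CO.sat_iff_forall`).
The rule for recursiveness is sound since `X ⇝ Y` can hold in a model only if there is a directed
path from `X` to `Y` (`transGen_of_sat_leadsTo`).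

Completeness is proved by contraposition. If `Γ` does not derive `ψ`, extend `Γ` to a set `Δ` that
is maximal among those that do not derive `ψ`. Every formula `φ` is provably equivalent to
the intuitionistic disjunction of finitely many `CO`-formulas, its resolutions
(`Deriv.bigIor_resolutions`, `Deriv.of_mem_resolutions`), and `Δ` contains a resolution of each of
its members by the elimination rule for the intuitionistic disjunction. So the
team of all models of the `CO`-formulas in `Δ` satisfies `Γ`. If it satisfied `ψ`, it would satisfy
a resolution `β` of `ψ`; by completeness for conclusions in `CO` (`Deriv.of_forall_model`), `Δ`
would derive `β` and hence `ψ`.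

For a conclusion `β` in `CO`, a set `Δ` that is maximal among those that do not derive `β` decides
all `CO`-formulas, and it describes a model. For each consistent equation `e` and each variable
`X`, there is exactly one value `x` such that `e □→ X = x` is in `Δ`; this is
`interventionValue Δ e X`. In the canonical system of functions, the parents of `V` are
the other variables that causally affect `V` according to `Δ`, and `F_V` gives the value of `V`
after an intervention on exactly the parents. The rule for recursiveness excludes cycles. The values
after `do(e)` solve the equations of this system (`MaximalAvoiding.interventionValue_eq_fn`): by
composition, all variables other than `V` may be fixed at the values that they have after
`do(e)`, and then those that do not causally affect `V` may be released one at a time. The truth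
lemma `MaximalAvoiding.sat_intervene_canonicalModel_iff` follows by induction on the formula, where
nested interventions collapse on both sides.
-/

namespace CausalTeam

universe u v

variable {σ : Signature.{u, v}}

/-! ### Interventions -/

namespace Equation

theorem value_eq_none_iff {e : Equation σ} {V : σ.Dom} :
    e.value V = none ↔ ∀ x : σ.Ran V, (⟨V, x⟩ : Σ X : σ.Dom, σ.Ran X) ∉ e := by
  unfold value
  split <;> simp_all

theorem mem_of_value_eq_some {e : Equation σ} {V : σ.Dom} {x : σ.Ran V}
    (h : e.value V = some x) : (⟨V, x⟩ : Σ X : σ.Dom, σ.Ran X) ∈ e := by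
  unfold value at h
  split at h
  · rename_i hx
    rw [← Option.some.inj h]
    exact hx.choose_spec
  · cases h

theorem Consistent.value_eq_some_iff {e : Equation σ} (he : e.Consistent) {V : σ.Dom}
    {x : σ.Ran V} : e.value V = some x ↔ (⟨V, x⟩ : Σ X : σ.Dom, σ.Ran X) ∈ e := by
  refine ⟨mem_of_value_eq_some, fun h => ?_⟩
  cases hv : e.value V with
  | none => exact absurd h (value_eq_none_iff.1 hv x)
  | some y => rw [he V x y h (mem_of_value_eq_some hv)]

theorem Consistent.mono {e e' : Equation σ} (he : e.Consistent) (h : ∀ p ∈ e', p ∈ e) :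
    e'.Consistent := fun X x x' hx hx' => he X x x' (h _ hx) (h _ hx')

theorem consistent_zero : (0 : Equation σ).Consistent := fun X x x' hx => by simp at hx

theorem consistent_singleton (X : σ.Dom) (x : σ.Ran X) :
    ({⟨X, x⟩} : Equation σ).Consistent := fun Y y y' h h' => by
  rw [Multiset.mem_singleton] at h h'
  simpa using h.trans h'.symm

theorem mem_sdiff {e e' : Equation σ} {V : σ.Dom} {x : σ.Ran V} :
    (⟨V, x⟩ : Σ X : σ.Dom, σ.Ran X) ∈ e.sdiff e' ↔
      (⟨V, x⟩ : Σ X : σ.Dom, σ.Ran X) ∈ e ∧ e'.value V = none := by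
  simp only [sdiff, Multiset.mem_filter, value_eq_none_iff]
  refine and_congr_right fun _ => ⟨fun h y hy => h _ hy rfl, ?_⟩
  rintro h ⟨W, y⟩ hy rfl
  exact h y hy

theorem Consistent.sdiff_add {e e' : Equation σ} (he : e.Consistent) (he' : e'.Consistent) :
    (e.sdiff e' + e').Consistent := by
  intro X x x' h h'
  simp only [Multiset.mem_add, mem_sdiff, value_eq_none_iff] at h h'
  rcases h with h | h <;> rcases h' with h' | h'
  · exact he X x x' h.1 h'.1
  · exact absurd h' (h.2 x')
  · exact absurd h (h'.2 x)
  · exact he' X x x' h h'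

/-- The equation that describes `do(e)` followed by `do(e')`: `e'` takes precedence. -/
theorem value_sdiff_add {e e' : Equation σ} (he : e.Consistent) (he' : e'.Consistent)
    (V : σ.Dom) : (e.sdiff e' + e').value V = (e'.value V).or (e.value V) := by
  ext x
  rw [(he.sdiff_add he').value_eq_some_iff, Multiset.mem_add, mem_sdiff]
  cases h' : e'.value V with
  | none => simpa [he.value_eq_some_iff] using fun h => absurd h (value_eq_none_iff.1 h' x)
  | some y => simp [← he'.value_eq_some_iff, h']

theorem VarDisjoint.sdiff_eq {e e' : Equation σ} (h : e.VarDisjoint e') : e.sdiff e' = e := by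
  simp only [sdiff, Multiset.filter_eq_self]
  exact fun p hp q hq => (h p hp q hq).symm

theorem VarDisjoint.consistent_add {e e' : Equation σ} (h : e.VarDisjoint e')
    (he : e.Consistent) (he' : e'.Consistent) : (e + e').Consistent := by
  simpa [h.sdiff_eq] using he.sdiff_add he'

theorem Consistent.cons {e : Equation σ} (he : e.Consistent) {W : σ.Dom} {w : σ.Ran W}
    (h : ∀ y, (⟨W, y⟩ : Σ X : σ.Dom, σ.Ran X) ∈ e → y = w) :
    Consistent (⟨W, w⟩ ::ₘ e) := by
  intro X x x' hx hx'
  rw [Multiset.mem_cons] at hx hx'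
  rcases hx with hx | hx <;> rcases hx' with hx' | hx'
  · simpa using hx.trans hx'.symm
  · cases hx; exact (h _ hx').symm
  · cases hx'; exact h _ hx
  · exact he X x x' hx hx'

theorem mem_ofPartial {z : ∀ V : σ.Dom, Option (σ.Ran V)} {V : σ.Dom} {x : σ.Ran V} :
    (⟨V, x⟩ : Σ X : σ.Dom, σ.Ran X) ∈ ofPartial z ↔ z V = some x := by
  unfold ofPartial
  simp only [Multiset.mem_filterMap, Finset.mem_val, Finset.mem_univ, true_and,
    Option.map_eq_some_iff]
  constructor
  · rintro ⟨W, y, hy, h⟩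
    cases h
    exact hy
  · exact fun h => ⟨V, x, h, rfl⟩

theorem consistent_ofPartial (z : ∀ V : σ.Dom, Option (σ.Ran V)) :
    (ofPartial z).Consistent := fun X x x' h h' => by
  rw [mem_ofPartial] at h h'
  simpa using h.symm.trans h'

end Equation

/-- The equations for `doAssign` determine it. -/
theorem FunSystem.eq_doAssign {F : FunSystem σ} (hF : F.Recursive) {e : Equation σ}
    {s t : Assignment σ} (h₁ : ∀ V x, e.value V = some x → t V = x)
    (h₂ : ∀ V, e.value V = none → F.law V = none → t V = s V)
    (h₃ : ∀ V l, e.value V = none → F.law V = some l → t V = l.fn fun P => t P) :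
    t = F.doAssign hF e s := by
  funext V
  induction V using hF.wf.induction with
  | _ V ih =>
    cases hv : e.value V with
    | some x => rw [h₁ V x hv, doAssign_of_value hF s hv]
    | none =>
      cases hl : F.law V with
      | none => rw [h₂ V hv hl, doAssign_of_exogenous hF s hv hl]
      | some l =>
        rw [h₃ V l hv hl, doAssign_of_law hF s hv hl]
        congr 1
        funext P
        exact ih P ⟨l, hl, P.2⟩

namespace Model

theorem eq_intervene {m m' : Model σ} {e : Equation σ}
    (hF : ∀ V, m'.F.law V = (m.F.restrict e).law V)
    (h₁ : ∀ V x, e.value V = some x → m'.s V = x)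
    (h₂ : ∀ V, e.value V = none → m.F.law V = none → m'.s V = m.s V)
    (h₃ : ∀ V l, e.value V = none → m.F.law V = some l → m'.s V = l.fn fun P => m'.s P) :
    m' = m.intervene e := by
  refine Model.ext (FunSystem.eq_doAssign m.recursive h₁ h₂ h₃) ?_
  show m'.F = m.F.restrict e
  cases h : m'.F
  cases h' : m.F.restrict e
  congr 1
  funext V
  simpa [h, h'] using hF V

theorem intervene_congr (m : Model σ) {e e' : Equation σ} (h : ∀ V, e.value V = e'.value V) :
    m.intervene e = m.intervene e' := by
  refine eq_intervene ?_ ?_ ?_ ?_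
  · intro V
    simp only [intervene, FunSystem.restrict, h V]
  · intro V x hv
    exact FunSystem.doAssign_of_value (Model.recursive _) _ ((h V).trans hv)
  · intro V hv hl
    exact FunSystem.doAssign_of_exogenous (Model.recursive _) _ ((h V).trans hv) hl
  · intro V l hv hl
    exact FunSystem.doAssign_of_law (Model.recursive _) _ ((h V).trans hv) hl

@[simp]
theorem intervene_zero (m : Model σ) : m.intervene 0 = m := by
  have hv : ∀ V, (0 : Equation σ).value V = none := fun V => by
    simp [Equation.value_eq_none_iff]
  refine (eq_intervene ?_ ?_ ?_ ?_).symm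
  · intro V
    simp [FunSystem.restrict, hv]
  · intro V x h
    simp [hv] at h
  · exact fun _ _ _ => rfl
  · exact fun V l _ hl => m.compatible V l hl

theorem intervene_intervene (m : Model σ) {e e' : Equation σ} (he : e.Consistent)
    (he' : e'.Consistent) :
    (m.intervene e).intervene e' = m.intervene (e.sdiff e' + e') := by
  have hv := Equation.value_sdiff_add he he'
  refine eq_intervene ?_ ?_ ?_ ?_
  · intro V
    simp only [intervene, FunSystem.restrict, hv]
    cases e'.value V <;> rfl
  all_goals
    intro V
    rw [hv]
  · intro x hx
    cases h' : e'.value V with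
    | some y =>
      rw [h'] at hx
      exact FunSystem.doAssign_of_value (Model.recursive _) _ (h'.trans hx)
    | none =>
      rw [h'] at hx
      change e.value V = some x at hx
      refine (FunSystem.doAssign_of_exogenous (Model.recursive _) _ h' ?_).trans
        (FunSystem.doAssign_of_value (Model.recursive _) _ hx)
      simp [intervene, FunSystem.restrict, hx]
  · intro h hl
    rw [Option.or_eq_none_iff] at h
    refine (FunSystem.doAssign_of_exogenous (Model.recursive _) _ h.1 ?_).trans
      (FunSystem.doAssign_of_exogenous (Model.recursive _) _ h.2 hl)
    simp [intervene, FunSystem.restrict, h.2, hl]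
  · intro l h hl
    rw [Option.or_eq_none_iff] at h
    refine FunSystem.doAssign_of_law (Model.recursive _) _ h.1 ?_
    simp [intervene, FunSystem.restrict, h.2, hl]

theorem intervene_s_of_mem (m : Model σ) {e : Equation σ} (he : e.Consistent) {V : σ.Dom}
    {x : σ.Ran V} (h : (⟨V, x⟩ : Σ X : σ.Dom, σ.Ran X) ∈ e) : (m.intervene e).s V = x :=
  FunSystem.doAssign_of_value (Model.recursive _) _ (he.value_eq_some_iff.2 h)

/-- Setting `W` to the value that it has anyway changes no value (though it removes the law of `W`). -/
theorem intervene_cons_s (m : Model σ) {e : Equation σ} {W : σ.Dom} {w : σ.Ran W}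
    (he : Equation.Consistent (⟨W, w⟩ ::ₘ e)) (h : (m.intervene e).s W = w) :
    (m.intervene (⟨W, w⟩ ::ₘ e)).s = (m.intervene e).s := by
  have he₀ : e.Consistent := he.mono fun p hp => Multiset.mem_cons_of_mem hp
  have hn : ∀ V, Equation.value (⟨W, w⟩ ::ₘ e) V = none → e.value V = none := fun V hV => by
    rw [Equation.value_eq_none_iff] at hV ⊢
    exact fun x hx => hV x (Multiset.mem_cons_of_mem hx)
  refine (FunSystem.eq_doAssign m.recursive ?_ ?_ ?_).symm
  · intro V x hV
    rcases Multiset.mem_cons.1 (Equation.mem_of_value_eq_some hV) with h' | h'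
    · cases h'
      exact h
    · exact intervene_s_of_mem m he₀ h'
  · exact fun V hV hl => FunSystem.doAssign_of_exogenous (Model.recursive _) _ (hn V hV) hl
  · exact fun V l hV hl => FunSystem.doAssign_of_law (Model.recursive _) _ (hn V hV) hl

/-- Setting `X` has no effect on the variables that are not descendants of `X`. -/
theorem intervene_singleton_s (m : Model σ) {X Y : σ.Dom} (x : σ.Ran X) (hne : X ≠ Y)
    (h : ¬ Relation.TransGen m.F.Edge X Y) : (m.intervene {⟨X, x⟩}).s Y = m.s Y := by
  induction Y using m.recursive.wf.induction with
  | _ Y ih =>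
    have hv : Equation.value ({⟨X, x⟩} : Equation σ) Y = none := by
      rw [Equation.value_eq_none_iff]
      intro y hy
      rw [Multiset.mem_singleton] at hy
      exact hne (Sigma.mk.inj hy).1.symm
    cases hl : m.F.law Y with
    | none => exact FunSystem.doAssign_of_exogenous (Model.recursive _) _ hv hl
    | some l =>
      refine (FunSystem.doAssign_of_law (Model.recursive _) _ hv hl).trans ?_
      rw [m.compatible Y l hl]
      congr 1
      funext P
      have hP : m.F.Edge P Y := ⟨l, hl, P.2⟩
      refine ih P hP ?_ fun h' => h (h'.tail hP)
      rintro rfl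
      exact h (.single hP)

theorem edge_of_intervene {m : Model σ} {e : Equation σ} {X Y : σ.Dom}
    (h : (m.intervene e).F.Edge X Y) : m.F.Edge X Y :=
  let ⟨l, hl, hX⟩ := h
  ⟨l, (FunSystem.law_of_restrict hl).2, hX⟩

end Model

/-! ### Basic properties of satisfaction -/

/-- `CO`-formulas are flat. -/
theorem CO.sat_iff_forall (α : CO σ) (T : GTeam σ) : α.Sat T ↔ ∀ m ∈ T, α.Sat {m} := by
  induction α generalizing T with
  | atom X x => simp [CO.Sat]
  | neg α => simp [CO.Sat]
  | and α β ihα ihβ =>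
    simp only [CO.Sat]
    rw [ihα, ihβ]
    exact forall₂_and.symm
  | or α β ihα ihβ =>
    simp only [CO.Sat]
    constructor
    · rintro ⟨T₁, T₂, rfl, h₁, h₂⟩ m (hm | hm)
      · exact ⟨{m}, ∅, by simp, (ihα _).1 h₁ m hm, (ihβ _).2 (by simp)⟩
      · exact ⟨∅, {m}, by simp, (ihα _).2 (by simp), (ihβ _).1 h₂ m hm⟩
    · intro h
      refine ⟨{m ∈ T | α.Sat {m}}, {m ∈ T | β.Sat {m}}, ?_, (ihα _).2 fun m hm => hm.2,
        (ihβ _).2 fun m hm => hm.2⟩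
      ext m
      refine ⟨fun hm => hm.elim And.left And.left, fun hm => ?_⟩
      obtain ⟨T₁, T₂, hT, h₁, h₂⟩ := h m hm
      have hm' : m ∈ T₁ ∪ T₂ := hT ▸ rfl
      exact hm'.imp (fun h' => ⟨hm, (ihα _).1 h₁ m h'⟩) (fun h' => ⟨hm, (ihβ _).1 h₂ m h'⟩)
  | cf e α ih =>
    simp only [CO.Sat, Set.image_singleton]
    rw [ih]
    by_cases he : e.1.Consistent <;> simp [he]

theorem CO.sat_or_singleton {α β : CO σ} {m : Model σ} :
    (CO.or α β).Sat {m} ↔ α.Sat {m} ∨ β.Sat {m} := by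
  constructor
  · rintro ⟨T₁, T₂, hT, h₁, h₂⟩
    have hm : m ∈ T₁ ∪ T₂ := hT ▸ rfl
    exact hm.imp ((CO.sat_iff_forall _ _).1 h₁ m) ((CO.sat_iff_forall _ _).1 h₂ m)
  · have hemp : ∀ γ : CO σ, γ.Sat ∅ := fun γ => (CO.sat_iff_forall _ _).2 (by simp)
    rintro (h | h)
    · exact ⟨{m}, ∅, by simp, h, hemp β⟩
    · exact ⟨∅, {m}, by simp, hemp α, h⟩

theorem COV.Sat.mono {φ : COV σ} {T T' : GTeam σ} (h : φ.Sat T) (hT : T' ⊆ T) : φ.Sat T' := by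
  induction φ generalizing T T' with
  | atom X x => exact fun m hm => h m (hT hm)
  | neg α => exact fun m hm => h m (hT hm)
  | and φ ψ ihφ ihψ => exact ⟨ihφ h.1 hT, ihψ h.2 hT⟩
  | or φ ψ ihφ ihψ =>
    obtain ⟨T₁, T₂, rfl, h₁, h₂⟩ := h
    refine ⟨T₁ ∩ T', T₂ ∩ T', ?_, ihφ h₁ Set.inter_subset_left, ihψ h₂ Set.inter_subset_left⟩
    rw [← Set.union_inter_distrib_right]
    exact Set.inter_eq_right.2 hT
  | ior φ ψ ihφ ihψ => exact h.imp (ihφ · hT) (ihψ · hT)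
  | cf e φ ih => exact h.imp id (ih · (Set.image_mono hT))

theorem COV.sat_empty (φ : COV σ) : φ.Sat ∅ := by
  induction φ with
  | atom X x => simp [COV.Sat]
  | neg α => simp [COV.Sat]
  | and φ ψ ihφ ihψ => exact ⟨ihφ, ihψ⟩
  | or φ ψ ihφ ihψ => exact ⟨∅, ∅, by simp, ihφ, ihψ⟩
  | ior φ ψ ihφ ihψ => exact .inl ihφ
  | cf e φ ih => exact .inr (by simpa using ih)

theorem COV.sat_bot {X : σ.Dom} {x : σ.Ran X} {T : GTeam σ} :
    (COV.bot X x).Sat T ↔ T = ∅ := by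
  constructor
  · rintro ⟨h₁, h₂⟩
    rw [Set.eq_empty_iff_forall_notMem]
    exact fun m hm => h₂ m hm (by simpa [CO.Sat] using h₁ m hm)
  · rintro rfl
    exact COV.sat_empty _

theorem COV.sat_would {e : Equation σ} {φ : COV σ} {T : GTeam σ} :
    (COV.would e φ).Sat T ↔ ¬ e.Consistent ∨ φ.Sat ((fun m => m.intervene e) '' T) := by
  unfold COV.would
  split
  · subst_vars
    simp [Equation.consistent_zero]
  · rfl

theorem CO.sat_would_singleton {e : Equation σ} {α : CO σ} {m : Model σ} :
    (CO.would e α).Sat {m} ↔ ¬ e.Consistent ∨ α.Sat {m.intervene e} := by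
  rw [← CO.sat_toCOV, CO.toCOV_would, COV.sat_would, Set.image_singleton, CO.sat_toCOV]

theorem CO.sat_bigOr_singleton {l : List (CO σ)} {m : Model σ} :
    (CO.bigOr l).Sat {m} ↔ ∃ α ∈ l, α.Sat {m} := by
  match l with
  | [] => simp [CO.bigOr, CO.bot, CO.Sat]
  | [α] => simp [CO.bigOr]
  | α :: β :: l =>
    rw [CO.bigOr, CO.sat_or_singleton, CO.sat_bigOr_singleton (l := β :: l)]
    simp

theorem CO.CfFree.sat_singleton_congr {α : CO σ} (hα : α.CfFree) {m m' : Model σ}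
    (h : m.s = m'.s) : α.Sat {m} ↔ α.Sat {m'} := by
  induction α with
  | atom X x => simp [CO.Sat, h]
  | neg α ih => simpa [CO.Sat] using not_congr (ih hα)
  | and α β ihα ihβ => exact and_congr (ihα hα.1) (ihβ hα.2)
  | or α β ihα ihβ =>
    rw [CO.sat_or_singleton, CO.sat_or_singleton]
    exact or_congr (ihα hα.1) (ihβ hα.2)
  | cf e α => exact hα.elim

/-- The satisfaction of a formula without counterfactuals depends only on the assignments in the
team. Teams are given as images of one team, so that splittings can be transported. -/
theorem COV.CfFree.sat_image {γ : COV σ} (hγ : γ.CfFree) {f g : Model σ → Model σ}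
    {T : GTeam σ} (hfg : ∀ m ∈ T, (f m).s = (g m).s) (h : γ.Sat (f '' T)) :
    γ.Sat (g '' T) := by
  induction γ generalizing T with
  | atom X x =>
    rintro _ ⟨m, hm, rfl⟩
    rw [← hfg m hm]
    exact h _ ⟨m, hm, rfl⟩
  | neg α =>
    rintro _ ⟨m, hm, rfl⟩
    rw [← CO.CfFree.sat_singleton_congr hγ (hfg m hm)]
    exact h _ ⟨m, hm, rfl⟩
  | and φ ψ ihφ ihψ => exact ⟨ihφ hγ.1 hfg h.1, ihψ hγ.2 hfg h.2⟩
  | or φ ψ ihφ ihψ =>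
    obtain ⟨T₁, T₂, hT, h₁, h₂⟩ := h
    have hsub : ∀ S ⊆ f '' T, f '' (T ∩ f ⁻¹' S) = S := fun S hS => by
      rw [Set.image_inter_preimage]
      exact Set.inter_eq_right.2 hS
    refine ⟨g '' (T ∩ f ⁻¹' T₁), g '' (T ∩ f ⁻¹' T₂), ?_,
      ihφ hγ.1 (fun m hm => hfg m hm.1) ?_, ihψ hγ.2 (fun m hm => hfg m hm.1) ?_⟩
    · rw [← Set.image_union, ← Set.inter_union_distrib_left, ← Set.preimage_union, hT,
        Set.inter_eq_left.2 (Set.subset_preimage_image f T)]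
    · rwa [hsub _ (hT ▸ Set.subset_union_left)]
    · rwa [hsub _ (hT ▸ Set.subset_union_right)]
  | ior φ ψ ihφ ihψ => exact h.imp (ihφ hγ.1 hfg) (ihψ hγ.2 hfg)
  | cf e φ => exact hγ.elim

/-- If `X` causally affects `Y`, then there is a directed path from `X` to `Y`. -/
theorem transGen_of_sat_leadsTo {m : Model σ} {X Y : σ.Dom} (hne : X ≠ Y)
    (h : (CO.leadsTo X Y).Sat {m}) : Relation.TransGen m.F.Edge X Y := by
  by_contra hn
  obtain ⟨α, hα, h⟩ := CO.sat_bigOr_singleton.1 h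
  obtain ⟨⟨z, ⟨x, x'⟩, ⟨y, y'⟩⟩, hi, rfl⟩ := List.mem_map.1 hα
  simp only [Finset.mem_toList, Finset.mem_filter] at hi
  have hn' : ¬ Relation.TransGen (m.intervene (Equation.ofPartial z)).F.Edge X Y := fun h' =>
    hn (Relation.TransGen.mono (fun _ _ => Model.edge_of_intervene) _ _ h')
  rw [CO.sat_would_singleton] at h
  obtain ⟨h₁, h₂⟩ := h.resolve_left (not_not_intro (Equation.consistent_ofPartial z))
  have key : ∀ (a : σ.Ran X) (b : σ.Ran Y),
      (CO.would {⟨X, a⟩} (.atom Y b)).Sat {m.intervene (Equation.ofPartial z)} →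
      b = (m.intervene (Equation.ofPartial z)).s Y := fun a b hab => by
    rw [CO.sat_would_singleton] at hab
    rw [← hab.resolve_left (not_not_intro (Equation.consistent_singleton X a)) _ rfl,
      Model.intervene_singleton_s _ a hne hn']
  exact hi.2.2.2.2 ((key _ _ h₁).trans (key _ _ h₂).symm)

/-! ### Soundness -/

theorem COV.sat_would_congr {e e' : Equation σ} (h : ∀ p, p ∈ e ↔ p ∈ e') {φ : COV σ}
    {T : GTeam σ} : (COV.would e φ).Sat T ↔ (COV.would e' φ).Sat T := by
  have hc : e.Consistent ↔ e'.Consistent :=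
    ⟨fun he => he.mono fun p hp => (h p).2 hp, fun he => he.mono fun p hp => (h p).1 hp⟩
  rw [COV.sat_would, COV.sat_would, ← hc]
  by_cases he : e.Consistent
  · have hv : ∀ V, e.value V = e'.value V := fun V => by
      ext x
      rw [he.value_eq_some_iff, (hc.1 he).value_eq_some_iff, h]
    simp only [Model.intervene_congr _ hv]
  · simp [he]

theorem Entails.orE {Γ : Set (COV σ)} {φ ψ : COV σ} {α : CO σ} (h : Entails Γ (.or φ ψ))
    (h₁ : Entails (insert φ Γ) α.toCOV) (h₂ : Entails (insert ψ Γ) α.toCOV) :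
    Entails Γ α.toCOV := by
  intro T hT
  obtain ⟨T₁, T₂, rfl, hφ, hψ⟩ := h T hT
  have s₁ := h₁ T₁ (Set.forall_mem_insert.2
    ⟨hφ, fun χ hχ => (hT χ hχ).mono Set.subset_union_left⟩)
  have s₂ := h₂ T₂ (Set.forall_mem_insert.2
    ⟨hψ, fun χ hχ => (hT χ hχ).mono Set.subset_union_right⟩)
  rw [CO.sat_toCOV, CO.sat_iff_forall] at s₁ s₂ ⊢
  exact fun m hm => hm.elim (s₁ m) (s₂ m)

theorem COV.sat_would_or {e : Equation σ} {φ ψ : COV σ} {T : GTeam σ} :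
    (COV.would e (.or φ ψ)).Sat T ↔ (COV.or (COV.would e φ) (COV.would e ψ)).Sat T := by
  constructor
  · intro h
    rcases COV.sat_would.1 h with he | ⟨T₁, T₂, hT, h₁, h₂⟩
    · exact ⟨T, T, Set.union_self T, COV.sat_would.2 (.inl he), COV.sat_would.2 (.inl he)⟩
    · refine ⟨T ∩ (fun m => m.intervene e) ⁻¹' T₁, T ∩ (fun m => m.intervene e) ⁻¹' T₂, ?_,
        COV.sat_would.2 (.inr (h₁.mono ?_)), COV.sat_would.2 (.inr (h₂.mono ?_))⟩
      · rw [← Set.inter_union_distrib_left, ← Set.preimage_union, hT]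
        exact Set.inter_eq_left.2 (Set.subset_preimage_image _ T)
      all_goals
        rw [Set.image_inter_preimage]
        exact Set.inter_subset_right
  · rintro ⟨T₁, T₂, rfl, h₁, h₂⟩
    rw [COV.sat_would] at h₁ h₂ ⊢
    rcases h₁ with h₁ | h₁
    · exact .inl h₁
    rcases h₂ with h₂ | h₂
    · exact .inl h₂
    exact .inr ⟨_, _, (Set.image_union ..).symm, h₁, h₂⟩

theorem Deriv.sound {Γ : Set (COV σ)} {φ : COV σ} (d : Deriv Γ φ) : Entails Γ φ := by
  induction d with
  | assumption h => exact fun T hT => hT _ h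
  | valDef X =>
    intro T _
    rw [CO.sat_toCOV, CO.sat_iff_forall]
    intro m _
    rw [CO.valDef, CO.sat_bigOr_singleton]
    exact ⟨.atom X (m.s X), List.mem_map.2 ⟨m.s X, by simp, rfl⟩, by simp [CO.Sat]⟩
  | valUnq hne _ ih =>
    intro T hT m hm h
    exact hne ((ih T hT m hm).symm.trans (h m rfl))
  | andI _ _ ih₁ ih₂ => exact fun T hT => ⟨ih₁ T hT, ih₂ T hT⟩
  | andE₁ _ ih => exact fun T hT => (ih T hT).1
  | andE₂ _ ih => exact fun T hT => (ih T hT).2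
  | orI₁ _ ih => exact fun T hT => ⟨T, ∅, by simp, ih T hT, COV.sat_empty _⟩
  | orI₂ _ ih => exact fun T hT => ⟨∅, T, by simp, COV.sat_empty _, ih T hT⟩
  | orE _ _ _ ih ih₁ ih₂ => exact ih.orE ih₁ ih₂
  | negI _ ih =>
    intro T hT m hm h
    have := ih {m} (Set.forall_mem_insert.2 ⟨(CO.sat_toCOV _ _).2 h,
      fun χ hχ => (hT χ hχ).mono (Set.singleton_subset_iff.2 hm)⟩)
    exact Set.singleton_ne_empty m (COV.sat_bot.1 this)
  | negE _ _ ih₁ ih₂ =>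
    intro T hT
    have : T = ∅ := Set.eq_empty_iff_forall_notMem.2 fun m hm => ih₂ T hT m hm
      ((CO.sat_iff_forall _ _).1 ((CO.sat_toCOV _ _).1 (ih₁ T hT)) m hm)
    exact this ▸ COV.sat_empty _
  | raa _ ih =>
    intro T hT
    rw [CO.sat_toCOV, CO.sat_iff_forall]
    intro m hm
    by_contra h
    have := ih {m} (Set.forall_mem_insert.2 ⟨by simpa [COV.Sat] using h,
      fun χ hχ => (hT χ hχ).mono (Set.singleton_subset_iff.2 hm)⟩)
    exact Set.singleton_ne_empty m (COV.sat_bot.1 this)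
  | cfEff e Y y =>
    intro T _
    rw [COV.sat_would]
    refine or_iff_not_imp_left.2 fun he => ?_
    rintro _ ⟨m, _, rfl⟩
    exact Model.intervene_s_of_mem m (not_not.1 he) (Multiset.mem_cons_self _ _)
  | cfCmp hγ _ _ ih₁ ih₂ =>
    intro T hT
    have h₁ := ih₁ T hT
    have h₂ := ih₂ T hT
    rw [COV.sat_would] at h₁ h₂ ⊢
    refine or_iff_not_imp_left.2 fun he => ?_
    rw [not_not] at he
    have he₀ := not_not_intro (he.mono fun p hp => Multiset.mem_cons_of_mem hp)
    refine hγ.sat_image (fun m hm => ?_) (h₂.resolve_left he₀)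
    exact (Model.intervene_cons_s m he (h₁.resolve_left he₀ _ ⟨m, hm, rfl⟩)).symm
  | cfBotE he _ ih =>
    intro T hT
    have h := (COV.sat_would.1 (ih T hT)).resolve_left (not_not_intro he)
    rw [COV.sat_bot, Set.image_eq_empty] at h
    exact h ▸ COV.sat_empty _
  | botCfE φ e hne =>
    intro T _
    exact COV.sat_would.2 (.inl fun he => hne (he _ _ _ (by simp) (by simp)))
  | cfCtr _ ih => exact fun T hT => (COV.sat_would_congr (by simp)).1 (ih T hT)
  | cfWk _ ih => exact fun T hT => (COV.sat_would_congr (by simp)).1 (ih T hT)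
  | cfSub _ _ ih₁ ih₂ =>
    intro T hT
    exact COV.sat_would.2 ((COV.sat_would.1 (ih₁ T hT)).imp id fun h => ih₂ _ (by simpa using h))
  | cfAndI _ _ ih₁ ih₂ =>
    intro T hT
    have h₁ := ih₁ T hT
    have h₂ := ih₂ T hT
    rw [COV.sat_would] at h₁ h₂ ⊢
    rcases h₁ with h₁ | h₁
    · exact .inl h₁
    exact h₂.imp id fun h₂ => ⟨h₁, h₂⟩
  | cfOrDst _ ih => exact fun T hT => COV.sat_would_or.1 (ih T hT)
  | cfOrDstInv _ ih => exact fun T hT => COV.sat_would_or.2 (ih T hT)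
  | @cfExtr _ _ e e' he _ ih =>
    intro T hT
    rw [COV.sat_would]
    refine or_iff_not_imp_left.2 fun hc => ?_
    have he' : e'.Consistent := (not_not.1 hc).mono fun p hp => Multiset.mem_add.2 (.inr hp)
    have h := (COV.sat_would.1 ((COV.sat_would.1 (ih T hT)).resolve_left
      (not_not_intro he))).resolve_left (not_not_intro he')
    simpa only [Set.image_image, Model.intervene_intervene _ he he'] using h
  | @cfExp _ _ e e' hd _ ih =>
    intro T hT
    rw [COV.sat_would, or_iff_not_imp_left, not_not]
    intro he
    rw [COV.sat_would, or_iff_not_imp_left, not_not]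
    intro he'
    have h := (COV.sat_would.1 (ih T hT)).resolve_left
      (not_not_intro (hd.consistent_add he he'))
    simpa only [Set.image_image, Model.intervene_intervene _ he he', hd.sdiff_eq] using h
  | negCfE _ ih =>
    intro T hT
    rw [COV.sat_would, or_iff_not_imp_left]
    rintro - _ ⟨m, hm, rfl⟩ h
    exact ih T hT m hm (CO.sat_would_singleton.2 (.inr h))
  | @recur _ k X hX _ ih =>
    intro T hT m hm h
    have path : ∀ i : Fin (k + 1), Relation.TransGen m.F.Edge (X 0) (X i.succ) := by
      have step : ∀ i : Fin (k + 1), Relation.TransGen m.F.Edge (X i.castSucc) (X i.succ) :=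
        fun i => transGen_of_sat_leadsTo (hX.ne Fin.castSucc_lt_succ.ne)
          ((CO.sat_iff_forall _ _).1 ((CO.sat_toCOV _ _).1 (ih i T hT)) m hm)
      intro i
      induction i using Fin.induction with
      | zero => exact step 0
      | succ i hi => exact hi.trans (step i.succ)
    exact m.recursive (X 0) ((path (Fin.last k)).trans
      (transGen_of_sat_leadsTo (hX.ne (Fin.last_pos.ne')) h))
  | orCom _ ih =>
    intro T hT
    obtain ⟨T₁, T₂, rfl, h₁, h₂⟩ := ih T hT
    exact ⟨T₂, T₁, Set.union_comm _ _, h₂, h₁⟩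
  | orAss _ ih =>
    intro T hT
    obtain ⟨_, T₃, rfl, ⟨T₁, T₂, rfl, h₁, h₂⟩, h₃⟩ := ih T hT
    exact ⟨T₁, T₂ ∪ T₃, (Set.union_assoc ..).symm, h₁, T₂, T₃, rfl, h₂, h₃⟩
  | orSub _ _ ih₁ ih₂ =>
    intro T hT
    obtain ⟨T₁, T₂, rfl, h₁, h₂⟩ := ih₁ T hT
    exact ⟨T₁, T₂, rfl, ih₂ T₁ (Set.forall_mem_insert.2
      ⟨h₁, fun χ hχ => (hT χ hχ).mono Set.subset_union_left⟩), h₂⟩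
  | iorI₁ _ ih => exact fun T hT => .inl (ih T hT)
  | iorI₂ _ ih => exact fun T hT => .inr (ih T hT)
  | iorE _ _ _ ih ih₁ ih₂ =>
    exact fun T hT => (ih T hT).elim (fun h => ih₁ T (Set.forall_mem_insert.2 ⟨h, hT⟩))
      (fun h => ih₂ T (Set.forall_mem_insert.2 ⟨h, hT⟩))
  | orIorDst _ ih =>
    intro T hT
    obtain ⟨T₁, T₂, hU, h₁, h₂⟩ := ih T hT
    exact h₂.imp (fun h => ⟨T₁, T₂, hU, h₁, h⟩) (fun h => ⟨T₁, T₂, hU, h₁, h⟩)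
  | cfIorDst _ ih =>
    intro T hT
    rcases COV.sat_would.1 (ih T hT) with h | h | h
    · exact .inl (COV.sat_would.2 (.inl h))
    · exact .inl (COV.sat_would.2 (.inr h))
    · exact .inr (COV.sat_would.2 (.inr h))

/-! ### Structural properties of derivations -/

namespace Deriv

theorem mono {Γ Γ' : Set (COV σ)} {φ : COV σ} (d : Deriv Γ φ) (h : Γ ⊆ Γ') : Deriv Γ' φ := by
  induction d generalizing Γ' with
  | assumption hφ => exact .assumption (h hφ)
  | valDef X => exact .valDef X
  | valUnq hne _ ih => exact .valUnq hne (ih h)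
  | andI _ _ ih₁ ih₂ => exact .andI (ih₁ h) (ih₂ h)
  | andE₁ _ ih => exact .andE₁ (ih h)
  | andE₂ _ ih => exact .andE₂ (ih h)
  | orI₁ _ ih => exact .orI₁ (ih h)
  | orI₂ _ ih => exact .orI₂ (ih h)
  | orE _ _ _ ih ih₁ ih₂ =>
    exact .orE (ih h) (ih₁ (Set.insert_subset_insert h)) (ih₂ (Set.insert_subset_insert h))
  | negI _ ih => exact .negI (ih (Set.insert_subset_insert h))
  | negE _ _ ih₁ ih₂ => exact .negE (ih₁ h) (ih₂ h)
  | raa _ ih => exact .raa (ih (Set.insert_subset_insert h))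
  | cfEff e Y y => exact .cfEff e Y y
  | cfCmp hγ _ _ ih₁ ih₂ => exact .cfCmp hγ (ih₁ h) (ih₂ h)
  | cfBotE he _ ih => exact .cfBotE he (ih h)
  | botCfE φ e hne => exact .botCfE φ e hne
  | cfCtr _ ih => exact .cfCtr (ih h)
  | cfWk _ ih => exact .cfWk (ih h)
  | cfSub _ d ih _ => exact .cfSub (ih h) d
  | cfAndI _ _ ih₁ ih₂ => exact .cfAndI (ih₁ h) (ih₂ h)
  | cfOrDst _ ih => exact .cfOrDst (ih h)
  | cfOrDstInv _ ih => exact .cfOrDstInv (ih h)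
  | cfExtr he _ ih => exact .cfExtr he (ih h)
  | cfExp hd _ ih => exact .cfExp hd (ih h)
  | negCfE _ ih => exact .negCfE (ih h)
  | recur X hX _ ih => exact .recur X hX fun i => ih i h
  | orCom _ ih => exact .orCom (ih h)
  | orAss _ ih => exact .orAss (ih h)
  | orSub _ _ ih₁ ih₂ => exact .orSub (ih₁ h) (ih₂ (Set.insert_subset_insert h))
  | iorI₁ _ ih => exact .iorI₁ (ih h)
  | iorI₂ _ ih => exact .iorI₂ (ih h)
  | iorE _ _ _ ih ih₁ ih₂ =>
    exact .iorE (ih h) (ih₁ (Set.insert_subset_insert h)) (ih₂ (Set.insert_subset_insert h))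
  | orIorDst _ ih => exact .orIorDst (ih h)
  | cfIorDst _ ih => exact .cfIorDst (ih h)

/-- Cut: a special case of the elimination of the intuitionistic disjunction `φ ⩖ φ`. -/
theorem cut {Γ : Set (COV σ)} {φ ψ : COV σ} (h : Deriv Γ φ) (d : Deriv (insert φ Γ) ψ) :
    Deriv Γ ψ := .iorE (.iorI₁ h) d d

theorem trans {Γ : Set (COV σ)} {φ ψ : COV σ} (h : Deriv Γ φ) (d : Deriv {φ} ψ) :
    Deriv Γ ψ := h.cut (d.mono (by simp))

theorem head (Γ : Set (COV σ)) (φ : COV σ) : Deriv (insert φ Γ) φ :=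
  .assumption (Set.mem_insert _ _)

theorem weaken {Γ : Set (COV σ)} {φ : COV σ} (d : Deriv Γ φ) (ψ : COV σ) :
    Deriv (insert ψ Γ) φ := d.mono (Set.subset_insert _ _)

theorem botE {Γ : Set (COV σ)} {X : σ.Dom} {x : σ.Ran X} (h : Deriv Γ (COV.bot X x))
    (φ : COV σ) : Deriv Γ φ := .negE (α := .atom X x) (.andE₁ h) (.andE₂ h)

/-- Derivations use finitely many assumptions. -/
theorem exists_finite {Γ : Set (COV σ)} {φ : COV σ} (d : Deriv Γ φ) :
    ∃ s ⊆ Γ, s.Finite ∧ Deriv s φ := by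
  have one : ∀ {Γ : Set (COV σ)} {φ ψ : COV σ}, (∃ s ⊆ Γ, s.Finite ∧ Deriv s φ) →
      (∀ {s}, Deriv s φ → Deriv s ψ) → ∃ s ⊆ Γ, s.Finite ∧ Deriv s ψ :=
    fun ⟨s, hs, hf, d⟩ h => ⟨s, hs, hf, h d⟩
  have two : ∀ {Γ : Set (COV σ)} {φ ψ χ : COV σ}, (∃ s ⊆ Γ, s.Finite ∧ Deriv s φ) →
      (∃ s ⊆ Γ, s.Finite ∧ Deriv s ψ) →
      (∀ {s}, Deriv s φ → Deriv s ψ → Deriv s χ) → ∃ s ⊆ Γ, s.Finite ∧ Deriv s χ :=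
    fun ⟨s, hs, hf, d⟩ ⟨s', hs', hf', d'⟩ h =>
      ⟨s ∪ s', Set.union_subset hs hs', hf.union hf',
        h (d.mono Set.subset_union_left) (d'.mono Set.subset_union_right)⟩
  have discharge : ∀ {Γ : Set (COV σ)} {φ ψ : COV σ},
      (∃ s ⊆ insert φ Γ, s.Finite ∧ Deriv s ψ) →
      ∃ s ⊆ Γ, s.Finite ∧ Deriv (insert φ s) ψ :=
    fun {Γ φ ψ} ⟨s, hs, hf, d⟩ =>
      ⟨s \ {φ}, Set.sdiff_singleton_subset_iff.2 hs, hf.sdiff, d.mono (by simp)⟩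
  induction d with
  | @assumption _ φ h =>
    exact ⟨{φ}, Set.singleton_subset_iff.2 h, Set.finite_singleton φ, .assumption rfl⟩
  | valDef X => exact ⟨∅, Set.empty_subset _, Set.finite_empty, .valDef X⟩
  | valUnq hne _ ih => exact one ih (.valUnq hne)
  | andI _ _ ih₁ ih₂ => exact two ih₁ ih₂ .andI
  | andE₁ _ ih => exact one ih .andE₁
  | andE₂ _ ih => exact one ih .andE₂
  | orI₁ _ ih => exact one ih .orI₁
  | orI₂ _ ih => exact one ih .orI₂
  | orE _ _ _ ih ih₁ ih₂ =>
    obtain ⟨s, hs, hf, d⟩ := ih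
    obtain ⟨s₁, hs₁, hf₁, d₁⟩ := discharge ih₁
    obtain ⟨s₂, hs₂, hf₂, d₂⟩ := discharge ih₂
    exact ⟨s ∪ (s₁ ∪ s₂), by simp [*], hf.union (hf₁.union hf₂),
      .orE (d.mono (by simp)) (d₁.mono (Set.insert_subset_insert (by grind)))
        (d₂.mono (Set.insert_subset_insert (by grind)))⟩
  | negI _ ih =>
    obtain ⟨s, hs, hf, d⟩ := discharge ih
    exact ⟨s, hs, hf, .negI d⟩
  | negE _ _ ih₁ ih₂ => exact two ih₁ ih₂ .negE
  | raa _ ih =>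
    obtain ⟨s, hs, hf, d⟩ := discharge ih
    exact ⟨s, hs, hf, .raa d⟩
  | cfEff e Y y => exact ⟨∅, Set.empty_subset _, Set.finite_empty, .cfEff e Y y⟩
  | cfCmp hγ _ _ ih₁ ih₂ => exact two ih₁ ih₂ (.cfCmp hγ)
  | cfBotE he _ ih => exact one ih (.cfBotE he)
  | botCfE φ e hne => exact ⟨∅, Set.empty_subset _, Set.finite_empty, .botCfE φ e hne⟩
  | cfCtr _ ih => exact one ih .cfCtr
  | cfWk _ ih => exact one ih .cfWk
  | cfSub _ d ih _ => exact one ih (.cfSub · d)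
  | cfAndI _ _ ih₁ ih₂ => exact two ih₁ ih₂ .cfAndI
  | cfOrDst _ ih => exact one ih .cfOrDst
  | cfOrDstInv _ ih => exact one ih .cfOrDstInv
  | cfExtr he _ ih => exact one ih (.cfExtr he)
  | cfExp hd _ ih => exact one ih (.cfExp hd)
  | negCfE _ ih => exact one ih .negCfE
  | recur X hX _ ih =>
    choose s hs hf d using ih
    exact ⟨⋃ i, s i, Set.iUnion_subset hs, Set.finite_iUnion hf,
      .recur X hX fun i => (d i).mono (Set.subset_iUnion s i)⟩
  | orCom _ ih => exact one ih .orCom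
  | orAss _ ih => exact one ih .orAss
  | orSub _ _ ih₁ ih₂ =>
    obtain ⟨s, hs, hf, d⟩ := ih₁
    obtain ⟨s', hs', hf', d'⟩ := discharge ih₂
    exact ⟨s ∪ s', Set.union_subset hs hs', hf.union hf',
      .orSub (d.mono (by simp)) (d'.mono (Set.insert_subset_insert (by simp)))⟩
  | iorI₁ _ ih => exact one ih .iorI₁
  | iorI₂ _ ih => exact one ih .iorI₂
  | iorE _ _ _ ih ih₁ ih₂ =>
    obtain ⟨s, hs, hf, d⟩ := ih
    obtain ⟨s₁, hs₁, hf₁, d₁⟩ := discharge ih₁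
    obtain ⟨s₂, hs₂, hf₂, d₂⟩ := discharge ih₂
    exact ⟨s ∪ (s₁ ∪ s₂), by simp [*], hf.union (hf₁.union hf₂),
      .iorE (d.mono (by simp)) (d₁.mono (Set.insert_subset_insert (by grind)))
        (d₂.mono (Set.insert_subset_insert (by grind)))⟩
  | orIorDst _ ih => exact one ih .orIorDst
  | cfIorDst _ ih => exact one ih .cfIorDst

end Deriv

/-- `Δ` is maximal among the sets of formulas that do not derive `ψ`. -/
structure MaximalAvoiding (Δ : Set (COV σ)) (ψ : COV σ) : Prop where
  not_deriv : ¬ Deriv Δ ψ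
  deriv_insert : ∀ φ ∉ Δ, Deriv (insert φ Δ) ψ

/-- Lindenbaum's lemma. -/
theorem exists_maximalAvoiding {Γ : Set (COV σ)} {ψ : COV σ} (h : ¬ Deriv Γ ψ) :
    ∃ Δ, Γ ⊆ Δ ∧ MaximalAvoiding Δ ψ := by
  obtain ⟨Δ, hΓ, hΔ⟩ := zorn_subset_nonempty {Δ | ¬ Deriv Δ ψ} (fun c hc hchain hne =>
    ⟨⋃₀ c, fun d => by
      obtain ⟨s, hs, hf, d⟩ := d.exists_finite
      obtain ⟨Δ, hΔ, hsΔ⟩ :=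
        DirectedOn.exists_mem_subset_of_finset_subset_biUnion (f := id) (s := hf.toFinset) hne
          hchain.directedOn (by simpa [Set.sUnion_eq_biUnion] using hs)
      exact hc hΔ (d.mono (by simpa using hsΔ)), fun _ => Set.subset_sUnion_of_mem⟩) Γ h
  refine ⟨Δ, hΓ, hΔ.prop, fun φ hφ => ?_⟩
  by_contra hn
  exact hφ (hΔ.le_of_ge hn (Set.subset_insert φ Δ) (Set.mem_insert φ Δ))

theorem MaximalAvoiding.mem_iff {Δ : Set (COV σ)} {ψ φ : COV σ} (hΔ : MaximalAvoiding Δ ψ) :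
    φ ∈ Δ ↔ Deriv Δ φ := by
  refine ⟨.assumption, fun h => ?_⟩
  by_contra hn
  exact hΔ.not_deriv (h.cut (hΔ.deriv_insert φ hn))

/-! ### Disjunctive normal form -/

/-- The `CO`-formulas, one for each way to choose a disjunct of each occurrence of the
intuitionistic disjunction, whose intuitionistic disjunction is equivalent to the formula. -/
def COV.resolutions : COV σ → List (CO σ)
  | .atom X x => [.atom X x]
  | .neg α => [.neg α]
  | .and φ ψ => φ.resolutions.flatMap fun α => ψ.resolutions.map fun β => .and α β
  | .or φ ψ => φ.resolutions.flatMap fun α => ψ.resolutions.map fun β => .or α β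
  | .ior φ ψ => φ.resolutions ++ ψ.resolutions
  | .cf e φ => φ.resolutions.map (.cf e)

/-- The intuitionistic disjunction of a list of `CO`-formulas; it is `⊥` for the empty list. -/
noncomputable def COV.bigIor : List (CO σ) → COV σ
  | [] => COV.bot (Classical.arbitrary σ.Dom) (Classical.arbitrary _)
  | [α] => α.toCOV
  | α :: β :: l => .ior α.toCOV (COV.bigIor (β :: l))

theorem COV.resolutions_ne_nil (φ : COV σ) : φ.resolutions ≠ [] := by
  induction φ with
  | ior φ ψ ihφ _ => simp [COV.resolutions, ihφ]
  | _ => simp_all [COV.resolutions, List.eq_nil_iff_forall_not_mem]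

theorem COV.would_of_ne_zero (e : {e : Equation σ // e ≠ 0}) (φ : COV σ) :
    COV.would e.1 φ = .cf e φ := dif_neg e.2

namespace Deriv

theorem bigIor_intro {Γ : Set (COV σ)} {l : List (CO σ)} {α : CO σ} (hα : α ∈ l)
    (h : Deriv Γ α.toCOV) : Deriv Γ (COV.bigIor l) := by
  match l with
  | [β] => exact List.mem_singleton.1 hα ▸ h
  | β :: γ :: l =>
    rcases List.mem_cons.1 hα with rfl | hα
    · exact .iorI₁ h
    · exact .iorI₂ (bigIor_intro hα h)

theorem bigIor_elim {Γ : Set (COV σ)} {l : List (CO σ)} {χ : COV σ}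
    (h : Deriv Γ (COV.bigIor l)) (hl : ∀ α ∈ l, Deriv (insert α.toCOV Γ) χ) : Deriv Γ χ := by
  match l with
  | [] => exact h.botE χ
  | [α] => exact h.cut (hl α (by simp))
  | α :: β :: l =>
    refine .iorE h (hl α (by simp)) (bigIor_elim (head _ _) fun γ hγ => ?_)
    exact (hl γ (List.mem_cons_of_mem _ hγ)).mono
      (Set.insert_subset_insert (Set.subset_insert _ _))

theorem or_bigIor_elim {Γ : Set (COV σ)} {l : List (CO σ)} {φ χ : COV σ} (hne : l ≠ [])
    (h : Deriv Γ (.or φ (COV.bigIor l)))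
    (hl : ∀ α ∈ l, Deriv (insert (.or φ α.toCOV) Γ) χ) : Deriv Γ χ := by
  match l with
  | [α] => exact h.cut (hl α (by simp))
  | α :: β :: l =>
    refine .iorE (.orIorDst h) (hl α (by simp))
      (or_bigIor_elim (List.cons_ne_nil β l) (head _ _) fun γ hγ => ?_)
    exact (hl γ (List.mem_cons_of_mem _ hγ)).mono
      (Set.insert_subset_insert (Set.subset_insert _ _))

theorem would_bigIor_elim {Γ : Set (COV σ)} {l : List (CO σ)} {e : Equation σ} {χ : COV σ}
    (hne : l ≠ []) (h : Deriv Γ (COV.would e (COV.bigIor l)))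
    (hl : ∀ α ∈ l, Deriv (insert (COV.would e α.toCOV) Γ) χ) : Deriv Γ χ := by
  match l with
  | [α] => exact h.cut (hl α (by simp))
  | α :: β :: l =>
    refine .iorE (.cfIorDst h) (hl α (by simp))
      (would_bigIor_elim (List.cons_ne_nil β l) (head _ _) fun γ hγ => ?_)
    exact (hl γ (List.mem_cons_of_mem _ hγ)).mono
      (Set.insert_subset_insert (Set.subset_insert _ _))

theorem or_congr {Γ : Set (COV σ)} {φ φ' ψ ψ' : COV σ} (h : Deriv Γ (.or φ ψ))
    (hφ : Deriv {φ} φ') (hψ : Deriv {ψ} ψ') : Deriv Γ (.or φ' ψ') :=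
  .orCom (.orSub (.orCom (.orSub h ((head Γ φ).trans hφ))) ((head Γ ψ).trans hψ))

theorem bigIor_resolutions (φ : COV σ) : Deriv {φ} (COV.bigIor φ.resolutions) := by
  induction φ with
  | atom X x => exact .assumption rfl
  | neg α => exact .assumption rfl
  | and φ ψ ihφ ihψ =>
    have h : Deriv {.and φ ψ} (.and φ ψ) := .assumption rfl
    refine bigIor_elim (h.andE₁.trans ihφ) fun α hα => ?_
    refine bigIor_elim ((h.andE₂.trans ihψ).weaken _) fun β hβ => ?_
    refine bigIor_intro (α := .and α β) ?_ (.andI ((head _ _).weaken _) (head _ _))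
    exact List.mem_flatMap.2 ⟨α, hα, List.mem_map.2 ⟨β, hβ, rfl⟩⟩
  | or φ ψ ihφ ihψ =>
    have h : Deriv {.or φ ψ} (.or (COV.bigIor φ.resolutions) (COV.bigIor ψ.resolutions)) :=
      or_congr (.assumption rfl) ihφ ihψ
    refine or_bigIor_elim ψ.resolutions_ne_nil h fun β hβ => ?_
    refine or_bigIor_elim φ.resolutions_ne_nil (head _ _).orCom fun α hα => ?_
    refine bigIor_intro (α := .or α β) ?_ (head _ _).orCom
    exact List.mem_flatMap.2 ⟨α, hα, List.mem_map.2 ⟨β, hβ, rfl⟩⟩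
  | ior φ ψ ihφ ihψ =>
    refine .iorE (.assumption rfl) ?_ ?_
    · exact bigIor_elim ((head _ _).trans ihφ) fun α hα =>
        bigIor_intro (List.mem_append_left _ hα) (head _ _)
    · exact bigIor_elim ((head _ _).trans ihψ) fun α hα =>
        bigIor_intro (List.mem_append_right _ hα) (head _ _)
  | cf e φ ih =>
    have h : Deriv {.cf e φ} (COV.would e.1 φ) :=
      .assumption (COV.would_of_ne_zero e φ)
    refine would_bigIor_elim φ.resolutions_ne_nil (.cfSub h ih) fun α hα => ?_
    refine bigIor_intro (List.mem_map_of_mem hα) ?_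
    rw [COV.would_of_ne_zero]
    exact head _ _

theorem of_mem_resolutions {φ : COV σ} {α : CO σ} (hα : α ∈ φ.resolutions) :
    Deriv {α.toCOV} φ := by
  induction φ generalizing α with
  | atom X x => exact .assumption (List.mem_singleton.1 hα ▸ rfl)
  | neg β => exact .assumption (List.mem_singleton.1 hα ▸ rfl)
  | and φ ψ ihφ ihψ =>
    obtain ⟨β, hβ, hα⟩ := List.mem_flatMap.1 hα
    obtain ⟨γ, hγ, rfl⟩ := List.mem_map.1 hα
    have h : Deriv {(CO.and β γ).toCOV} (.and β.toCOV γ.toCOV) := .assumption rfl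
    exact .andI (h.andE₁.trans (ihφ hβ)) (h.andE₂.trans (ihψ hγ))
  | or φ ψ ihφ ihψ =>
    obtain ⟨β, hβ, hα⟩ := List.mem_flatMap.1 hα
    obtain ⟨γ, hγ, rfl⟩ := List.mem_map.1 hα
    exact or_congr (.assumption rfl) (ihφ hβ) (ihψ hγ)
  | ior φ ψ ihφ ihψ =>
    exact (List.mem_append.1 hα).elim (fun h => .iorI₁ (ihφ h)) (fun h => .iorI₂ (ihψ h))
  | cf e φ ih =>
    obtain ⟨β, hβ, rfl⟩ := List.mem_map.1 hα
    rw [← COV.would_of_ne_zero]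
    exact .cfSub (.assumption (COV.would_of_ne_zero e _)) (ih hβ)

end Deriv

theorem COV.exists_sat_of_sat_bigIor {l : List (CO σ)} (hl : l ≠ []) {T : GTeam σ}
    (h : (COV.bigIor l).Sat T) : ∃ α ∈ l, α.Sat T := by
  match l with
  | [α] => exact ⟨α, by simp, (CO.sat_toCOV _ _).1 h⟩
  | α :: β :: l =>
    rcases h with h | h
    · exact ⟨α, by simp, (CO.sat_toCOV _ _).1 h⟩
    · obtain ⟨γ, hγ, h⟩ := COV.exists_sat_of_sat_bigIor (List.cons_ne_nil β l) h
      exact ⟨γ, List.mem_cons_of_mem _ hγ, h⟩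

/-- Satisfaction by a team is satisfaction of one of the resolutions, the same for the whole team. -/
theorem COV.exists_sat_resolution {φ : COV σ} {T : GTeam σ} (h : φ.Sat T) :
    ∃ α ∈ φ.resolutions, α.Sat T :=
  COV.exists_sat_of_sat_bigIor φ.resolutions_ne_nil
    ((Deriv.bigIor_resolutions φ).sound T (by simpa using h))

theorem COV.sat_of_sat_resolution {φ : COV σ} {α : CO σ} (hα : α ∈ φ.resolutions)
    {T : GTeam σ} (h : α.Sat T) : φ.Sat T :=
  (Deriv.of_mem_resolutions hα).sound T (by simpa [CO.sat_toCOV] using h)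

/-- A set that is maximal among those that do not derive `ψ` is prime with respect to the
intuitionistic disjunction. -/
theorem MaximalAvoiding.exists_resolution_mem {Δ : Set (COV σ)} {ψ φ : COV σ}
    (hΔ : MaximalAvoiding Δ ψ) (hφ : φ ∈ Δ) : ∃ α ∈ φ.resolutions, α.toCOV ∈ Δ := by
  by_contra! hn
  exact hΔ.not_deriv (((Deriv.assumption hφ).trans (Deriv.bigIor_resolutions φ)).bigIor_elim
    fun α hα => hΔ.deriv_insert _ (hn α hα))

/-! ### Counterfactuals in derivations -/

namespace Deriv

/-- Necessitation. -/
theorem would_of_forall {φ : COV σ} (h : ∀ Γ, Deriv Γ φ) (Γ : Set (COV σ)) (e : Equation σ) :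
    Deriv Γ (COV.would e φ) := by
  induction e using Multiset.induction with
  | empty => simpa [COV.would] using h Γ
  | cons p e _ => exact .cfSub (.cfEff e p.1 p.2) (h _)

theorem would_of_not_consistent {e : Equation σ} (he : ¬ e.Consistent) (Γ : Set (COV σ))
    (φ : COV σ) : Deriv Γ (COV.would e φ) := by
  simp only [Equation.Consistent, not_forall] at he
  obtain ⟨X, x, x', hx, hx', hne⟩ := he
  obtain ⟨e, rfl⟩ := Multiset.exists_cons_of_mem hx
  obtain ⟨e, rfl⟩ := Multiset.exists_cons_of_mem
    ((Multiset.mem_cons.1 hx').resolve_left (by simpa using Ne.symm hne))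
  exact .botCfE φ e hne

theorem would_valDef (Γ : Set (COV σ)) (e : Equation σ) (X : σ.Dom) :
    Deriv Γ (COV.would e (CO.valDef X).toCOV) := would_of_forall (fun _ => .valDef X) Γ e

theorem would_cons_self_iff {Γ : Set (COV σ)} {φ : COV σ} {e : Equation σ}
    {p : Σ X : σ.Dom, σ.Ran X} :
    Deriv Γ (COV.would (p ::ₘ p ::ₘ e) φ) ↔ Deriv Γ (COV.would (p ::ₘ e) φ) :=
  ⟨.cfCtr, .cfWk⟩

open Classical in
theorem would_add_dedup_iff {Γ : Set (COV σ)} {φ : COV σ} (e e' : Equation σ) :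
    Deriv Γ (COV.would (e.dedup + e') φ) ↔ Deriv Γ (COV.would (e + e') φ) := by
  induction e using Multiset.induction generalizing e' with
  | empty => simp
  | cons p e ih =>
    by_cases hp : p ∈ e
    · rw [Multiset.dedup_cons_of_mem hp, ih]
      obtain ⟨e, rfl⟩ := Multiset.exists_cons_of_mem hp
      simp only [Multiset.cons_add]
      exact would_cons_self_iff.symm
    · rw [Multiset.dedup_cons_of_notMem hp, Multiset.cons_add, ← Multiset.add_cons, ih,
        Multiset.add_cons, ← Multiset.cons_add]

/-- Repetitions in the antecedent of a counterfactual are irrelevant. -/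
theorem would_congr {Γ : Set (COV σ)} {φ : COV σ} {e e' : Equation σ}
    (h : ∀ p, p ∈ e ↔ p ∈ e') : Deriv Γ (COV.would e φ) ↔ Deriv Γ (COV.would e' φ) := by
  classical
  have he := would_add_dedup_iff (Γ := Γ) (φ := φ) e 0
  have he' := would_add_dedup_iff (Γ := Γ) (φ := φ) e' 0
  rw [add_zero, add_zero] at he he'
  rw [← he, ← he', Multiset.dedup_ext.2 h]

end Deriv

/-! ### Maximal sets avoiding a `CO`-formula -/

namespace MaximalAvoiding

variable {Δ : Set (COV σ)} {β : CO σ}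

theorem mem_of_deriv {ψ φ : COV σ} (hΔ : MaximalAvoiding Δ ψ) (h : Deriv Δ φ) : φ ∈ Δ :=
  hΔ.mem_iff.2 h

theorem or_mem_iff {φ χ : COV σ} (hΔ : MaximalAvoiding Δ β.toCOV) :
    .or φ χ ∈ Δ ↔ φ ∈ Δ ∨ χ ∈ Δ := by
  constructor
  · intro h
    by_contra! hn
    exact hΔ.not_deriv (.orE (.assumption h) (hΔ.deriv_insert _ hn.1) (hΔ.deriv_insert _ hn.2))
  · rintro (h | h)
    · exact hΔ.mem_of_deriv (.orI₁ (.assumption h))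
    · exact hΔ.mem_of_deriv (.orI₂ (.assumption h))

theorem neg_mem_iff {α : CO σ} (hΔ : MaximalAvoiding Δ β.toCOV) :
    .neg α ∈ Δ ↔ α.toCOV ∉ Δ := by
  constructor
  · exact fun h h' => hΔ.not_deriv (.negE (.assumption h') (.assumption h))
  · intro h
    by_contra hn
    obtain ⟨X⟩ := σ.domNonempty
    obtain ⟨x⟩ := σ.ranNonempty X
    -- Both `α` and `¬α` derive `β`; hence so does `Δ`, by reductio and the law of the
    -- excluded middle.
    refine hΔ.not_deriv (.raa (X := X) (x := x) ?_)
    have hα : Deriv (insert (.neg β) Δ) (.neg α) := by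
      refine .negI (X := X) (x := x) (.negE (α := β) ?_ ((Deriv.head _ _).weaken _))
      exact (hΔ.deriv_insert _ h).mono (Set.insert_subset_insert (Set.subset_insert _ _))
    refine .negE (α := β) (hα.cut ?_) (Deriv.head _ _)
    exact (hΔ.deriv_insert _ hn).mono (Set.insert_subset_insert (Set.subset_insert _ _))

theorem bigOr_mem {l : List (CO σ)} {ψ : COV σ} (hΔ : MaximalAvoiding Δ ψ) {α : CO σ}
    (hα : α ∈ l) (h : α.toCOV ∈ Δ) : (CO.bigOr l).toCOV ∈ Δ := by
  match l with
  | [γ] => exact List.mem_singleton.1 hα ▸ h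
  | γ :: δ :: l =>
    rcases List.mem_cons.1 hα with rfl | hα
    · exact hΔ.mem_of_deriv (.orI₁ (.assumption h))
    · exact hΔ.mem_of_deriv (.orI₂ (.assumption (hΔ.bigOr_mem hα h)))

theorem exists_would_mem_of_bigOr {l : List (CO σ)} (hΔ : MaximalAvoiding Δ β.toCOV)
    {e : Equation σ} (he : e.Consistent) (h : COV.would e (CO.bigOr l).toCOV ∈ Δ) :
    ∃ α ∈ l, COV.would e α.toCOV ∈ Δ := by
  match l with
  | [] => exact (hΔ.not_deriv (.cfBotE he (.assumption h))).elim
  | [α] => exact ⟨α, by simp, h⟩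
  | α :: γ :: l =>
    rcases hΔ.or_mem_iff.1 (hΔ.mem_of_deriv (.cfOrDst (.assumption h))) with h | h
    · exact ⟨α, by simp, h⟩
    · obtain ⟨δ, hδ, h⟩ := hΔ.exists_would_mem_of_bigOr he h
      exact ⟨δ, List.mem_cons_of_mem _ hδ, h⟩

theorem would_mem_congr {ψ φ : COV σ} (hΔ : MaximalAvoiding Δ ψ) {e e' : Equation σ}
    (h : ∀ p, p ∈ e ↔ p ∈ e') : COV.would e φ ∈ Δ ↔ COV.would e' φ ∈ Δ := by
  rw [hΔ.mem_iff, hΔ.mem_iff, Deriv.would_congr h]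

theorem would_neg_mem_iff {α : CO σ} (hΔ : MaximalAvoiding Δ β.toCOV) {e : Equation σ}
    (he : e.Consistent) : COV.would e (.neg α) ∈ Δ ↔ COV.would e α.toCOV ∉ Δ := by
  constructor
  · intro h h'
    obtain ⟨X⟩ := σ.domNonempty
    obtain ⟨x⟩ := σ.ranNonempty X
    have hand := Deriv.cfAndI (.assumption h') (.assumption h)
    exact hΔ.not_deriv (.cfBotE he (X := X) (x := x) (.cfSub hand
      (.negE (α := α) (.andE₁ (.assumption rfl)) (.andE₂ (.assumption rfl)))))
  · intro h
    rw [← CO.toCOV_would, ← hΔ.neg_mem_iff] at h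
    exact hΔ.mem_of_deriv (.negCfE (.assumption h))

/-- Nested counterfactuals collapse. -/
theorem would_would_mem_iff {α : CO σ} (hΔ : MaximalAvoiding Δ β.toCOV) {e e' : Equation σ}
    (he : e.Consistent) (he' : e'.Consistent) :
    COV.would e (COV.would e' α.toCOV) ∈ Δ ↔ COV.would (e.sdiff e' + e') α.toCOV ∈ Δ := by
  constructor
  · exact fun h => hΔ.mem_of_deriv (.cfExtr he (.assumption h))
  · intro h
    by_contra hn
    rw [← CO.toCOV_would, ← hΔ.would_neg_mem_iff he] at hn
    have hneg : COV.would (e.sdiff e' + e') (.neg α) ∈ Δ :=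
      hΔ.mem_of_deriv (.cfExtr he (.cfSub (.assumption hn) (.negCfE (.assumption rfl))))
    exact (hΔ.would_neg_mem_iff (he.sdiff_add he')).1 hneg h

end MaximalAvoiding

/-! ### The value of a variable after an intervention -/

open Classical in
/-- The assignment that results from the intervention `do(e)` according to `Δ`: `X` gets the
value `x` such that `e □→ X = x` is in `Δ`. The default value is not used if `e` is
consistent and `Δ` is maximal. -/
noncomputable def interventionValue (Δ : Set (COV σ)) (e : Equation σ) : Assignment σ := fun X =>
  if h : ∃ x, COV.would e (.atom X x) ∈ Δ then h.choose else Classical.arbitrary _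

open Classical in
/-- The equation that gives the variables in `S` their values under `u`. -/
noncomputable def Equation.ofAssignment (u : Assignment σ) (S : Set σ.Dom) : Equation σ :=
  Equation.ofPartial fun V => if V ∈ S then some (u V) else none

theorem Equation.mem_ofAssignment {u : Assignment σ} {S : Set σ.Dom} {V : σ.Dom} {x : σ.Ran V} :
    (⟨V, x⟩ : Σ X : σ.Dom, σ.Ran X) ∈ Equation.ofAssignment u S ↔ V ∈ S ∧ u V = x := by
  unfold Equation.ofAssignment
  rw [Equation.mem_ofPartial]
  split <;> simp_all

theorem Equation.consistent_ofAssignment (u : Assignment σ) (S : Set σ.Dom) :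
    (Equation.ofAssignment u S).Consistent := Equation.consistent_ofPartial _

namespace MaximalAvoiding

variable {Δ : Set (COV σ)} {β : CO σ}

theorem interventionValue_eq_iff (hΔ : MaximalAvoiding Δ β.toCOV) {e : Equation σ}
    (he : e.Consistent) {X : σ.Dom} {x : σ.Ran X} :
    interventionValue Δ e X = x ↔ COV.would e (.atom X x) ∈ Δ := by
  have hex : ∃ x, COV.would e (.atom X x) ∈ Δ := by
    obtain ⟨α, hα, h⟩ := hΔ.exists_would_mem_of_bigOr he
      (hΔ.mem_of_deriv (Deriv.would_valDef Δ e X))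
    obtain ⟨x, -, rfl⟩ := List.mem_map.1 hα
    exact ⟨x, h⟩
  have hmem : COV.would e (.atom X (interventionValue Δ e X)) ∈ Δ := by
    unfold interventionValue
    rw [dif_pos hex]
    exact hex.choose_spec
  refine ⟨fun h => h ▸ hmem, fun h => ?_⟩
  by_contra hne
  have hneg : COV.would e (.neg (.atom X x)) ∈ Δ :=
    hΔ.mem_of_deriv (.cfSub (.assumption hmem) (.valUnq hne (.assumption rfl)))
  exact (hΔ.would_neg_mem_iff he).1 hneg h

theorem interventionValue_congr (hΔ : MaximalAvoiding Δ β.toCOV) {e e' : Equation σ}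
    (he : e.Consistent) (h : ∀ p, p ∈ e ↔ p ∈ e') :
    interventionValue Δ e = interventionValue Δ e' := by
  funext X
  rw [hΔ.interventionValue_eq_iff he, hΔ.would_mem_congr h,
    ← hΔ.interventionValue_eq_iff (he.mono fun p hp => (h p).2 hp)]

/-- Effectiveness. -/
theorem interventionValue_of_mem (hΔ : MaximalAvoiding Δ β.toCOV) {e : Equation σ}
    (he : e.Consistent) {X : σ.Dom} {x : σ.Ran X}
    (h : (⟨X, x⟩ : Σ X : σ.Dom, σ.Ran X) ∈ e) : interventionValue Δ e X = x := by
  rw [hΔ.interventionValue_eq_iff he]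
  obtain ⟨e, rfl⟩ := Multiset.exists_cons_of_mem h
  exact hΔ.mem_of_deriv (.cfEff e X x)

/-- Composition. -/
theorem interventionValue_cons (hΔ : MaximalAvoiding Δ β.toCOV) {e : Equation σ}
    (he : e.Consistent) (W : σ.Dom) :
    Equation.Consistent (⟨W, interventionValue Δ e W⟩ ::ₘ e) ∧
      interventionValue Δ (⟨W, interventionValue Δ e W⟩ ::ₘ e) = interventionValue Δ e := by
  have hc : Equation.Consistent (⟨W, interventionValue Δ e W⟩ ::ₘ e) :=
    he.cons fun y hy => (hΔ.interventionValue_of_mem he hy).symm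
  refine ⟨hc, funext fun X => (hΔ.interventionValue_eq_iff hc).2 (hΔ.mem_of_deriv ?_)⟩
  exact .cfCmp trivial (.assumption ((hΔ.interventionValue_eq_iff he).1 rfl))
    (.assumption ((hΔ.interventionValue_eq_iff he).1 rfl))

/-- If `S` contains all variables of `e`, then setting the variables of `S` to the values that
they have after `do(e)` results in the same assignment as `do(e)`. -/
theorem interventionValue_ofAssignment (hΔ : MaximalAvoiding Δ β.toCOV) {e : Equation σ}
    (he : e.Consistent) {S : Set σ.Dom} (hS : ∀ p ∈ e, p.1 ∈ S) :
    interventionValue Δ (.ofAssignment (interventionValue Δ e) S) = interventionValue Δ e := by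
  classical
  have key : ∀ T : Finset σ.Dom, interventionValue Δ (.ofAssignment (interventionValue Δ e)
      {V | V ∈ T ∨ ∃ p ∈ e, p.1 = V}) = interventionValue Δ e := by
    intro T
    induction T using Finset.induction with
    | empty =>
      refine hΔ.interventionValue_congr (Equation.consistent_ofAssignment _ _) ?_
      rintro ⟨V, x⟩
      rw [Equation.mem_ofAssignment]
      constructor
      · rintro ⟨hV | ⟨⟨V, y⟩, hp, rfl⟩, rfl⟩
        · simp at hV
        · rwa [hΔ.interventionValue_of_mem he hp]
      · exact fun h => ⟨.inr ⟨_, h, rfl⟩, hΔ.interventionValue_of_mem he h⟩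
    | insert W T _ ih =>
      have h := (hΔ.interventionValue_cons (Equation.consistent_ofAssignment
        (interventionValue Δ e) {V | V ∈ T ∨ ∃ p ∈ e, p.1 = V}) W).2
      rw [ih] at h
      refine Eq.trans (hΔ.interventionValue_congr (Equation.consistent_ofAssignment _ _) ?_) h
      rintro ⟨V, x⟩
      rw [Multiset.mem_cons, Equation.mem_ofAssignment, Equation.mem_ofAssignment]
      by_cases hV : V = W
      · subst hV
        simp [eq_comm]
      · simp [hV]
  have hST : S = {V | V ∈ S.toFinset ∨ ∃ p ∈ e, p.1 = V} := by
    ext V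
    simp only [Set.mem_toFinset, Set.mem_ofPred_eq]
    exact ⟨.inl, fun h => h.elim id fun ⟨p, hp, hV⟩ => hV ▸ hS p hp⟩
  rw [hST, key]

theorem leadsTo_mem (hΔ : MaximalAvoiding Δ β.toCOV) {z : ∀ V : σ.Dom, Option (σ.Ran V)}
    {X Y : σ.Dom} {x x' : σ.Ran X} {y y' : σ.Ran Y} (hX : z X = none) (hY : z Y = none)
    (hx : x ≠ x') (hy : y ≠ y')
    (h : COV.would (⟨X, x⟩ ::ₘ Equation.ofPartial z) (.atom Y y) ∈ Δ)
    (h' : COV.would (⟨X, x'⟩ ::ₘ Equation.ofPartial z) (.atom Y y') ∈ Δ) :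
    (CO.leadsTo X Y).toCOV ∈ Δ := by
  classical
  have exp : ∀ {a : σ.Ran X} {b : σ.Ran Y},
      COV.would (⟨X, a⟩ ::ₘ Equation.ofPartial z) (.atom Y b) ∈ Δ →
      Deriv Δ (COV.would (Equation.ofPartial z) (COV.would {⟨X, a⟩} (.atom Y b))) := by
    intro a b hab
    refine .cfExp ?_ (.assumption ?_)
    · rintro ⟨V, c⟩ hc q hq rfl
      rw [Multiset.mem_singleton] at hq
      subst hq
      rw [Equation.mem_ofPartial, hX] at hc
      cases hc
    · rwa [add_comm, Multiset.singleton_add]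
  unfold CO.leadsTo
  refine hΔ.bigOr_mem (List.mem_map.2 ⟨(z, (x, x'), (y, y')), ?_, rfl⟩) ?_
  · rw [Finset.mem_toList, Finset.mem_filter]
    exact ⟨Finset.mem_univ _, hX, hY, hx, hy⟩
  · rw [CO.toCOV_would]
    refine hΔ.mem_of_deriv ?_
    simp only [CO.toCOV, CO.toCOV_would]
    exact .cfAndI (exp h) (exp h')

/-- A variable that does not causally affect `V` may be dropped from an intervention without
changing the value of `V`. -/
theorem interventionValue_insert (hΔ : MaximalAvoiding Δ β.toCOV) (u : Assignment σ)
    {S : Set σ.Dom} {V X : σ.Dom} (hV : V ∉ S) (hX : X ∉ S)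
    (h : (CO.leadsTo X V).toCOV ∉ Δ) :
    interventionValue Δ (.ofAssignment u (insert X S)) V =
      interventionValue Δ (.ofAssignment u S) V := by
  have hc := Equation.consistent_ofAssignment u
  obtain ⟨hc', hcomp⟩ := hΔ.interventionValue_cons (hc S) X
  have hmem : ∀ p, p ∈ Equation.ofAssignment u (insert X S) ↔
      p ∈ ⟨X, u X⟩ ::ₘ Equation.ofAssignment u S := by
    rintro ⟨W, w⟩
    rw [Multiset.mem_cons, Equation.mem_ofAssignment, Equation.mem_ofAssignment]
    by_cases hW : W = X
    · subst hW
      simp [hX, eq_comm]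
    · simp [hW]
  have hc'' : Equation.Consistent (⟨X, u X⟩ ::ₘ Equation.ofAssignment u S) :=
    (hc (insert X S)).mono fun p hp => (hmem p).2 hp
  rw [hΔ.interventionValue_congr (hc _) hmem]
  by_contra hne
  rw [← hcomp] at hne
  have hx : u X ≠ interventionValue Δ (Equation.ofAssignment u S) X := fun hx => by
    rw [← hx] at hne
    exact hne rfl
  exact h (hΔ.leadsTo_mem (if_neg hX) (if_neg hV) hx hne
    ((hΔ.interventionValue_eq_iff hc'').1 rfl) ((hΔ.interventionValue_eq_iff hc').1 rfl))

/-- Iteration of `interventionValue_insert`. -/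
theorem interventionValue_of_superset (hΔ : MaximalAvoiding Δ β.toCOV) (u : Assignment σ)
    {S S' : Set σ.Dom} {V : σ.Dom} (hS : S ⊆ S') (hV : V ∉ S')
    (h : ∀ X ∈ S', X ∉ S → (CO.leadsTo X V).toCOV ∉ Δ) :
    interventionValue Δ (.ofAssignment u S') V = interventionValue Δ (.ofAssignment u S) V := by
  classical
  have key : ∀ T : Finset σ.Dom, (∀ X ∈ T, X ∈ S' ∧ X ∉ S) →
      interventionValue Δ (.ofAssignment u (↑T ∪ S)) V =
        interventionValue Δ (.ofAssignment u S) V := by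
    intro T
    induction T using Finset.induction with
    | empty => simp
    | insert X T hXT ih =>
      intro hT
      have hX := hT X (Finset.mem_insert_self X T)
      have hT' : ∀ X ∈ T, X ∈ S' ∧ X ∉ S := fun Y hY => hT Y (Finset.mem_insert_of_mem hY)
      rw [Finset.coe_insert, Set.insert_union, hΔ.interventionValue_insert, ih hT']
      · rintro (hVT | hVS)
        · exact hV (hT' V hVT).1
        · exact hV (hS hVS)
      · rintro (hXT' | hXS)
        · exact hXT hXT'
        · exact hX.2 hXS
      · exact h X hX.1 hX.2
  have hT := key (S' \ S).toFinset (by simp)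
  rwa [Set.coe_toFinset, Set.sdiff_union_of_subset hS] at hT

end MaximalAvoiding

/-! ### Simple cycles -/

/-- A path of minimal length does not repeat vertices. -/
theorem exists_injective_path {ι : Type*} {r : ι → ι → Prop} {a b : ι}
    (h : Relation.ReflTransGen r a b) :
    ∃ (n : ℕ) (f : ℕ → ι), f 0 = a ∧ f n = b ∧ (∀ i < n, r (f i) (f (i + 1))) ∧
      Set.InjOn f (Set.Iic n) := by
  have hex : ∃ (n : ℕ) (f : ℕ → ι), f 0 = a ∧ f n = b ∧ ∀ i < n, r (f i) (f (i + 1)) := by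
    induction h with
    | refl => exact ⟨0, fun _ => a, rfl, rfl, by simp⟩
    | @tail b c _ hbc ih =>
      obtain ⟨n, f, h₀, h₁, hf⟩ := ih
      refine ⟨n + 1, fun i => if i ≤ n then f i else c, by simpa using h₀, by simp, ?_⟩
      intro i hi
      rcases Nat.lt_succ_iff_lt_or_eq.1 hi with hi | rfl
      · simpa [hi.le, Nat.succ_le_of_lt hi] using hf i hi
      · simpa [h₁] using hbc
  classical
  obtain ⟨f, h₀, h₁, hf⟩ := Nat.find_spec hex
  have hmin : ∀ {m}, m < Nat.find hex → _ := Nat.find_min hex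
  generalize Nat.find hex = n at h₁ hf hmin
  refine ⟨n, f, h₀, h₁, hf, ?_⟩
  have aux : ∀ i j, i < j → j ≤ n → f i ≠ f j := by
    intro i j hij hj heq
    -- The detour from `i` to `j` can be skipped.
    refine hmin (m := n - (j - i)) (by omega)
      ⟨fun k => if k ≤ i then f k else f (k + (j - i)), by simpa using h₀, ?_, ?_⟩
    · rcases hj.eq_or_lt with rfl | hj'
      · have h₂ : j - (j - i) = i := by omega
        simp only [h₂, le_refl, if_true]
        rw [heq, h₁]
      · have h₂ : ¬ n - (j - i) ≤ i := by omega
        have h₃ : n - (j - i) + (j - i) = n := by omega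
        simp only [h₂, if_false]
        rw [h₃, h₁]
    · intro k hk
      rcases lt_trichotomy k i with hki | rfl | hki
      · simpa [hki.le, Nat.succ_le_of_lt hki] using hf k (by omega)
      · have h₃ : k + 1 + (j - k) = j + 1 := by omega
        simpa [h₃, heq] using hf j (by omega)
      · have h₃ : k + 1 + (j - i) = k + (j - i) + 1 := by omega
        have h₄ : ¬ k ≤ i := by omega
        have h₅ : ¬ k + 1 ≤ i := by omega
        simpa only [h₃, h₄, h₅, if_false] using hf (k + (j - i)) (by omega)
  intro i hi j hj heq
  rcases lt_trichotomy i j with h | h | h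
  · exact (aux i j h hj heq).elim
  · exact h
  · exact (aux j i h hi heq.symm).elim

/-! ### The canonical model -/

/-- The canonical system of functions of `Δ`: all variables are endogenous, the parents of `V`
are the other variables that causally affect `V` according to `Δ`, and the value of `V` is the
one that `V` has according to `Δ` after the parents have been set. -/
noncomputable def canonicalSystem (Δ : Set (COV σ)) : FunSystem σ where
  law V := some
    { parents := {X | X ≠ V ∧ (CO.leadsTo X V).toCOV ∈ Δ}
      not_mem := fun h => h.1 rfl
      fn := fun p => interventionValue Δ (Equation.ofPartial (open Classical in fun X =>
        if h : X ≠ V ∧ (CO.leadsTo X V).toCOV ∈ Δ then some (p ⟨X, h⟩) else none)) V }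

namespace MaximalAvoiding

variable {Δ : Set (COV σ)} {β : CO σ}

theorem edge_canonicalSystem {X Y : σ.Dom} :
    (canonicalSystem Δ).Edge X Y ↔ X ≠ Y ∧ (CO.leadsTo X Y).toCOV ∈ Δ := by
  simp [FunSystem.Edge, canonicalSystem]

theorem recursive_canonicalSystem (hΔ : MaximalAvoiding Δ β.toCOV) :
    (canonicalSystem Δ).Recursive := by
  intro a h
  obtain ⟨c, hac, hca⟩ := Relation.TransGen.head'_iff.1 h
  rw [edge_canonicalSystem] at hac
  obtain ⟨n, f, h₀, h₁, hf, hinj⟩ := exists_injective_path hca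
  obtain _ | n := n
  · exact hac.1 (h₁.symm.trans h₀)
  have hneg : COV.neg (CO.leadsTo a c) ∈ Δ := by
    have := Deriv.recur (Γ := Δ) (k := n) (fun i : Fin (n + 2) => f i)
      (fun i j hij => Fin.ext (hinj (Nat.lt_succ_iff.1 i.2) (Nat.lt_succ_iff.1 j.2) hij))
      (fun i => .assumption (edge_canonicalSystem.1 (hf i i.2)).2)
    simp only [Fin.val_last, Fin.val_zero, h₀, h₁] at this
    exact hΔ.mem_of_deriv this
  exact hΔ.neg_mem_iff.1 hneg hac.2

/-- The values after an intervention satisfy the equations of the canonical system. -/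
theorem interventionValue_eq_fn (hΔ : MaximalAvoiding Δ β.toCOV) {e : Equation σ}
    (he : e.Consistent) {V : σ.Dom} (hV : e.value V = none) {l : Law V}
    (hl : (canonicalSystem Δ).law V = some l) :
    interventionValue Δ e V = l.fn fun P => interventionValue Δ e P := by
  obtain rfl := Option.some.inj hl
  rw [Equation.value_eq_none_iff] at hV
  have h₁ := hΔ.interventionValue_ofAssignment he (S := {V}ᶜ) <| by
    rintro ⟨W, w⟩ hp (rfl : W = V)
    exact hV w hp
  have h₂ := hΔ.interventionValue_of_superset (interventionValue Δ e)
    (S := {X | X ≠ V ∧ (CO.leadsTo X V).toCOV ∈ Δ}) (S' := {V}ᶜ) (V := V) (fun X hX => hX.1)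
    (by simp) (fun X hX hX' hmem => hX' ⟨hX, hmem⟩)
  rw [h₁] at h₂
  refine h₂.trans ?_
  unfold Equation.ofAssignment
  congr 2
  funext X
  by_cases hX : X ≠ V ∧ (CO.leadsTo X V).toCOV ∈ Δ
  · rw [dif_pos hX]
    exact if_pos hX
  · rw [dif_neg hX]
    exact if_neg hX

theorem interventionValue_zero_compatible (hΔ : MaximalAvoiding Δ β.toCOV) :
    (canonicalSystem Δ).Compatible (interventionValue Δ 0) := fun _ _ hl =>
  hΔ.interventionValue_eq_fn Equation.consistent_zero (by simp [Equation.value_eq_none_iff]) hl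

/-- The model described by a maximal set `Δ`. -/
noncomputable def canonicalModel (hΔ : MaximalAvoiding Δ β.toCOV) : Model σ where
  s := interventionValue Δ 0
  F := canonicalSystem Δ
  recursive := hΔ.recursive_canonicalSystem
  compatible := hΔ.interventionValue_zero_compatible

theorem intervene_canonicalModel_s (hΔ : MaximalAvoiding Δ β.toCOV) {e : Equation σ}
    (he : e.Consistent) : (hΔ.canonicalModel.intervene e).s = interventionValue Δ e := by
  refine (FunSystem.eq_doAssign (s := hΔ.canonicalModel.s) hΔ.recursive_canonicalSystem ?_ ?_ ?_).symm
  · exact fun V x hV => hΔ.interventionValue_of_mem he (Equation.mem_of_value_eq_some hV)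
  · exact fun V _ hl => (Option.some_ne_none _ hl).elim
  · exact fun V l hV hl => hΔ.interventionValue_eq_fn he hV hl

/-- Truth lemma. -/
theorem sat_intervene_canonicalModel_iff (hΔ : MaximalAvoiding Δ β.toCOV) (α : CO σ)
    {e : Equation σ} (he : e.Consistent) :
    α.Sat {hΔ.canonicalModel.intervene e} ↔ COV.would e α.toCOV ∈ Δ := by
  induction α generalizing e with
  | atom X x =>
    simp only [CO.Sat, Set.mem_singleton_iff, forall_eq]
    rw [hΔ.intervene_canonicalModel_s he, hΔ.interventionValue_eq_iff he]
    rfl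
  | neg α ih =>
    simp only [CO.Sat, Set.mem_singleton_iff, forall_eq]
    rw [ih he]
    exact (hΔ.would_neg_mem_iff he).symm
  | and α γ ihα ihγ =>
    refine (and_congr (ihα he) (ihγ he)).trans ⟨fun h => ?_, fun h => ⟨?_, ?_⟩⟩
    · exact hΔ.mem_of_deriv (.cfAndI (.assumption h.1) (.assumption h.2))
    · exact hΔ.mem_of_deriv (.cfSub (.assumption h) (.andE₁ (.assumption rfl)))
    · exact hΔ.mem_of_deriv (.cfSub (.assumption h) (.andE₂ (.assumption rfl)))
  | or α γ ihα ihγ =>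
    rw [CO.sat_or_singleton, ihα he, ihγ he, ← hΔ.or_mem_iff]
    exact ⟨fun h => hΔ.mem_of_deriv (.cfOrDstInv (.assumption h)),
      fun h => hΔ.mem_of_deriv (.cfOrDst (.assumption h))⟩
  | cf e' α ih =>
    simp only [CO.Sat, Set.image_singleton, CO.toCOV]
    rw [← COV.would_of_ne_zero]
    by_cases he' : e'.1.Consistent
    · rw [Model.intervene_intervene _ he he', ih (he.sdiff_add he'),
        hΔ.would_would_mem_iff he he']
      simp [he']
    · simp only [he', not_false_eq_true, true_or, true_iff]
      exact hΔ.mem_of_deriv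
        (Deriv.would_of_forall (fun _ => Deriv.would_of_not_consistent he' _ _) _ _)

theorem sat_canonicalModel_iff (hΔ : MaximalAvoiding Δ β.toCOV) (α : CO σ) :
    α.Sat {hΔ.canonicalModel} ↔ α.toCOV ∈ Δ := by
  simpa [COV.would] using hΔ.sat_intervene_canonicalModel_iff α Equation.consistent_zero

end MaximalAvoiding

/-! ### Completeness -/

/-- Completeness for conclusions in `CO`: the models that satisfy the `CO`-part of `Γ` are
enough. -/
theorem Deriv.of_forall_model {Γ : Set (COV σ)} {β : CO σ}
    (h : ∀ m : Model σ, (∀ α : CO σ, α.toCOV ∈ Γ → α.Sat {m}) → β.Sat {m}) :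
    Deriv Γ β.toCOV := by
  by_contra hn
  obtain ⟨Δ, hΓ, hΔ⟩ := exists_maximalAvoiding hn
  refine hΔ.not_deriv (.assumption ((hΔ.sat_canonicalModel_iff β).1 (h _ fun α hα => ?_)))
  exact (hΔ.sat_canonicalModel_iff α).2 (hΓ hα)

theorem Deriv.complete {Γ : Set (COV σ)} {ψ : COV σ} (h : Entails Γ ψ) : Deriv Γ ψ := by
  by_contra hn
  obtain ⟨Δ, hΓ, hΔ⟩ := exists_maximalAvoiding hn
  have hT : ψ.Sat {m | ∀ α : CO σ, α.toCOV ∈ Δ → α.Sat {m}} := by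
    refine h _ fun φ hφ => ?_
    obtain ⟨α, hα, hαΔ⟩ := hΔ.exists_resolution_mem (hΓ hφ)
    exact COV.sat_of_sat_resolution hα ((CO.sat_iff_forall _ _).2 fun m hm => hm α hαΔ)
  obtain ⟨β, hβ, hsat⟩ := COV.exists_sat_resolution hT
  exact hΔ.not_deriv ((Deriv.of_forall_model fun m hm =>
    (CO.sat_iff_forall _ _).1 hsat m hm).trans (Deriv.of_mem_resolutions hβ))

end CausalTeam

theorem theorem5p4 (σ : CausalTeam.Signature) (Γ : Set (CausalTeam.COV σ))
    (ψ : CausalTeam.COV σ) :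
    CausalTeam.Deriv Γ ψ ↔ CausalTeam.Entails Γ ψ :=
  ⟨CausalTeam.Deriv.sound, CausalTeam.Deriv.complete⟩
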